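/- Let $k$ be a field of arbitrary characteristic and $Y$ an algebraic curve over $k$ (complete, integral, geometrically irreducible, of dimension one). For a point $P$ of $Y$ let $\mathcal O=\widehat O_{P,Y}$ be the completed local ring and $\widetilde{\mathcal O}$ the completion, with respect to the Jacobson ideal, of the integral closure $\mathbb O_P$ of $O_{P,Y}$ in the function field of $Y$. Call $\mathcal O$ totally rational if every maximal ideal of $\mathbb O_P$ has residue field $k$; then $\widetilde{\mathcal O}\cong k[\![t_1]\!]\times\cdots\times k[\![t_d]\!]$ over $k$, and we fix such an identification. With $v_i$ the order in $t_i$, put $$S(\mathcal O)=\{(v_1(z_1),\dots,v_d(z_d)) : z=(z_1,\dots,z_d)\in\mathcal O \text{ a non-zero-divisor}\}\subseteq\mathbb N^d .$$ Let $c$ be the least element of $\mathbb N^d$ with $c+\mathbb N^d\subseteq S(\mathcal O)$, let $\mathcal F=t^{c}\widetilde{\mathcal O}$, let $\delta=\dim_k\widetilde{\mathcal O}/\mathcal O$, and let $\mathcal J=\widetilde{\mathcal O}^\times/\mathcal O^\times$, regarded as the algebraic group over $k$ that is the quotient of $\widetilde{\mathcal O}^\times/(1+\mathcal F)$ by its closed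 subgroup $\mathcal O^\times/(1+\mathcal F)$. We say that $k$ is big enough for $Y$ if at every singular point $P$ of $Y$ the ring $\mathcal O$ is totally rational and $\mathcal J\cong(\mathbb G_m)^{d-1}\times(\mathbb G_a)^{\delta-d+1}$ as algebraic groups. Let $\mathcal M_k=K_0(\mathrm{Var}_k)[\mathbb L^{-1}]$ with $\mathbb L=[\mathbb A^1_k]$. For $n\in S(\mathcal O)$ let $\mathcal I_n$ be the set of principal ideals $t^{n}\mu\,\mathcal O\subseteq\mathcal O$, $\mu\in\widetilde{\mathcal O}^\times$, identified with the closed subvariety $\{\mu\in\mathcal J : t^n\mu\in\mathcal O\}$ of $\mathcal J$, and put $$Z(T_1,\dots,T_d,\mathcal O)=\sum_{n\in S(\mathcal O)}[\mathcal I_n]\,\mathbb L^{-(n_1+\cdots+n_d)}\,T_1^{n_1}\cdots T_d^{n_d}\in\mathcal M_k[\![T_1,\dots,T_d]\!].$$ If $k$ is big enough for $Y$ and $P$ is a singular point of $Y$, then $Z(T_1,\dots,T_d,\mathcal O)$ is completely determined by the semigroup of values $S(\mathcal O)$. That is, there is an assignment $(d,S)\mapsto\mathcal Z_{d,S}\in\mathbb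 Z[U,U^{-1}][\![T_1,\dots,T_d]\!]$, for $d\in\mathbb N$ and $S$ a submonoid of $\mathbb N^d$, depending on nothing else, such that for all $k$, $Y$, $P$ as above, and all identifications of $\widetilde{\mathcal O}$ with $k[\![t_1]\!]\times\cdots\times k[\![t_d]\!]$, the series $Z(T_1,\dots,T_d,\mathcal O)$ is obtained from $\mathcal Z_{d,S(\mathcal O)}$ by substituting $U=\mathbb L$. In particular, for singular points on two curves for which the same field $k$ is big enough, equal semigroups of values in $\mathbb N^d$ give equal zeta functions. -/

import Mathlib

open AlgebraicGeometry CategoryTheory CategoryTheory.Limits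
open scoped PowerSeries LaurentPolynomial

universe u

noncomputable section

namespace CurveZeta

/-! ## The Grothendieck ring of varieties -/

section Grothendieck

variable (k : Type u) [Field k]

/-- Algebraic varieties over `k`: separated schemes of finite type over `k`. -/
structure Variety where
  /-- the scheme -/
  X : Scheme.{u}
  /-- the structure morphism -/
  hom : X ⟶ Spec (CommRingCat.of k)
  /-- locally of finite type -/
  locallyOfFiniteType : LocallyOfFiniteType hom
  /-- quasi-compact -/
  quasiCompact : QuasiCompact hom
  /-- separated -/
  isSeparated : IsSeparated hom

variable {k}

/-- The defining relations of the Grothendieck ring, as elements of the free commutative ring on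
the symbols `[V]`. -/
inductive GrothendieckRel : FreeCommRing (Variety.{u} k) → Prop
  /-- `[V] = [W]` for isomorphic varieties. -/
  | iso (V W : Variety.{u} k) (e : V.X ≅ W.X) (he : e.hom ≫ W.hom = V.hom) :
      GrothendieckRel (FreeCommRing.of V - FreeCommRing.of W)
  /-- `[V] = [V ∖ Z] + [Z]` for `Z` closed in `V`; here `U` is the open complement of `Z`. -/
  | scissors (V Z U : Variety.{u} k) (i : Z.X ⟶ V.X) (j : U.X ⟶ V.X)
      (hi : i ≫ V.hom = Z.hom) (hj : j ≫ V.hom = U.hom)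
      (hZ : IsClosedImmersion i) (hU : IsOpenImmersion j)
      (hc : Set.range j = (Set.range i)ᶜ) :
      GrothendieckRel (FreeCommRing.of V - (FreeCommRing.of U + FreeCommRing.of Z))
  /-- `[V × W] = [V] [W]`. -/
  | prod (V W Z : Variety.{u} k) (p : Z.X ⟶ V.X) (q : Z.X ⟶ W.X)
      (hp : p ≫ V.hom = Z.hom) (h : IsPullback p q V.hom W.hom) :
      GrothendieckRel (FreeCommRing.of Z - FreeCommRing.of V * FreeCommRing.of W)
  /-- `[point] = 1`. -/
  | point (V : Variety.{u} k) (h : IsIso V.hom) : GrothendieckRel (FreeCommRing.of V - 1)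

variable (k)

/-- The Grothendieck ring `K₀(Var_k)`. -/
abbrev K0 : Type (u + 1) :=
  FreeCommRing (Variety.{u} k) ⧸ Ideal.span {x : FreeCommRing (Variety.{u} k) | GrothendieckRel x}

variable {k}

open Classical in
/-- The class `[X]` in `K₀(Var_k)` of a `k`-scheme `X` which is a variety
(and `0`, by convention, if it is not). -/
def classOf {X : Scheme.{u}} (f : X ⟶ Spec (CommRingCat.of k)) : K0 k :=
  if h : LocallyOfFiniteType f ∧ QuasiCompact f ∧ IsSeparated f then
    Ideal.Quotient.mk _ (FreeCommRing.of ⟨X, f, h.1, h.2.1, h.2.2⟩)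
  else 0

/-- The class of the affine `k`-scheme `Spec A`. -/
def affineClass (A : Type u) [CommRing A] [Algebra k A] : K0 k :=
  classOf (Spec.map (CommRingCat.ofHom (algebraMap k A)))

variable (k)

/-- `𝕃 = [𝔸¹]`. -/
def lefschetz : K0 k := affineClass (k := k) (Polynomial k)

/-- `ℳ_k = K₀(Var_k)[𝕃⁻¹]`. -/
abbrev MotivicRing : Type (u + 1) := Localization.Away (lefschetz k)

/-- The unit `𝕃` of `ℳ_k`. -/
def lefschetzUnit : (MotivicRing k)ˣ :=
  (IsLocalization.Away.algebraMap_isUnit (S := MotivicRing k) (lefschetz k)).unit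

/-- The substitution `U ↦ 𝕃`, from integral Laurent polynomials in `U` to `ℳ_k`. -/
def substLefschetz : ℤ[T;T⁻¹] →+* MotivicRing k :=
  LaurentPolynomial.eval₂ (Int.castRingHom _) (lefschetzUnit k)

end Grothendieck

/-! ## Semigroup, conductor, unit group schemes and zeta function of a subring `𝒪` of
`𝒪~ = k⟦t₁⟧ × ⋯ × k⟦t_d⟧` -/

section LocalTheory

variable {k : Type u} [Field k] {d : ℕ} (O : Subalgebra k (Fin d → k⟦X⟧))

/-- The semigroup of values `S = {(v₁(z₁), …, v_d(z_d))}`, where `z` runs over the elements of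
`𝒪` with all components nonzero, i.e. the elements of `𝒪` that are non-zero-divisors. -/
def valueSemigroup : AddSubmonoid (Fin d → ℕ) where
  carrier := {n | ∃ z ∈ O, ∀ i, (z i).order = n i}
  zero_mem' := ⟨1, O.one_mem, fun i => by simp⟩
  add_mem' := by
    rintro a b ⟨z, hz, hza⟩ ⟨w, hw, hwb⟩
    exact ⟨z * w, O.mul_mem hz hw, fun i => by
      simp [PowerSeries.order_mul, hza i, hwb i]⟩

/-- The conductor `c` of `S`: the least `c ∈ ℕᵈ`, for the product order,
with `c + ℕᵈ ⊆ S`. -/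
def conductor : Fin d → ℕ :=
  sInf {n | ∀ m, n ≤ m → m ∈ valueSemigroup O}

/-- The singularity degree `δ = dim_k 𝒪~ / 𝒪`. -/
def singularityDegree : ℕ :=
  Module.finrank k ((Fin d → k⟦X⟧) ⧸ Subalgebra.toSubmodule O)

/-- The positions `(i, j)`, `j < c_i`, of the coefficients that survive modulo the conductor ideal
`ℱ = t^c 𝒪~`. -/
abbrev Pos : Type := Σ i : Fin d, Fin (conductor O i)

/-- The coordinate ring of the algebraic group `G = 𝒪~ˣ / (1 + ℱ)`: an element of `G` is
represented by `(∑_{j < c_i} a_{i,j} t_i^j)_i`, with all `a_{i,0}` invertible. -/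
abbrev UnitCoord : Type u :=
  Localization.Away (∏ p : Pos O with (p.2 : ℕ) = 0, (MvPolynomial.X p : MvPolynomial (Pos O) k))

/-- The coordinate function `a_{i,j}` on `G`. -/
def coord (p : Pos O) : UnitCoord O :=
  algebraMap (MvPolynomial (Pos O) k) (UnitCoord O) (MvPolynomial.X p)

lemma coord_isUnit (p : Pos O) (hp : (p.2 : ℕ) = 0) : IsUnit (coord O p) := by
  have h := IsLocalization.Away.algebraMap_isUnit (S := UnitCoord O)
    (∏ p : Pos O with (p.2 : ℕ) = 0, (MvPolynomial.X p : MvPolynomial (Pos O) k))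
  rw [map_prod] at h
  exact isUnit_of_dvd_unit (Finset.dvd_prod_of_mem _ (by simp [hp])) h

variable {O} in
/-- The `(i, j)`-coefficient of the product of two truncated tuples of power series. -/
def mulCoeff {R : Type u} [CommRing R] (a b : Pos O → R) (p : Pos O) : R :=
  ∑ q : Fin ((p.2 : ℕ) + 1),
    a ⟨p.1, (q : ℕ), lt_of_lt_of_le q.2 p.2.2⟩ *
      b ⟨p.1, (p.2 : ℕ) - q, (Nat.sub_le _ _).trans_lt p.2.2⟩

variable {O} in
/-- The product of two `R`-valued points of `G`, an `R`-valued point of `G` being a `k`-algebra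
homomorphism from the coordinate ring of `G` to `R`: multiply the tuples
`(∑_{j < c_i} a_{i,j} t_i^j)_i` of truncated power series. -/
def mulPoint {R : Type u} [CommRing R] [Algebra k R] (g h : UnitCoord O →ₐ[k] R) :
    UnitCoord O →ₐ[k] R :=
  IsLocalization.liftAlgHom
    (M := Submonoid.powers
      (∏ p : Pos O with (p.2 : ℕ) = 0, (MvPolynomial.X p : MvPolynomial (Pos O) k)))
    (f := MvPolynomial.aeval (mulCoeff (fun p => g (coord O p)) (fun p => h (coord O p))))
    (by
      rintro ⟨_, n, rfl⟩
      rw [map_pow]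
      refine IsUnit.pow n ?_
      rw [map_prod]
      refine (IsUnit.prod_iff (M := R)).2 fun p hp => ?_
      simp only [Finset.mem_filter, Finset.mem_univ, true_and] at hp
      obtain ⟨i, j, hj⟩ := p
      obtain rfl : j = 0 := hp
      simp only [MvPolynomial.aeval_X, mulCoeff]
      rw [Fin.sum_univ_one]
      exact ((coord_isUnit O ⟨i, 0, hj⟩ rfl).map g).mul ((coord_isUnit O ⟨i, 0, hj⟩ rfl).map h))

/-- The `R`-valued points of `𝒪 / ℱ` inside those of `𝒪~ / ℱ`: the `R`-span of the truncations of
the elements of `𝒪`. -/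
def ringPoints (R : Type u) [CommRing R] [Algebra k R] : Submodule R (Pos O → R) :=
  Submodule.span R
    {w | ∃ z ∈ O, w = fun p => algebraMap k R (PowerSeries.coeff (p.2 : ℕ) (z p.1))}

/-- The coordinate ring of the algebraic group `𝒥 = 𝒪~ˣ / 𝒪ˣ`, the quotient of
`G = 𝒪~ˣ / (1 + ℱ)` by the closed subgroup `H = 𝒪ˣ / (1 + ℱ)`: the functions `f` on `G` with
`f(g h) = f(g)` for all points `g` of `G` and `h` of `H` with values in any `k`-algebra. -/
def jacCoord : Subalgebra k (UnitCoord O) where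
  carrier := {f | ∀ (R : Type u) [CommRing R] [Algebra k R] (g h : UnitCoord O →ₐ[k] R),
    (fun p => h (coord O p)) ∈ ringPoints O R → mulPoint g h f = g f}
  mul_mem' := fun ha hb R _ _ g h hh => by rw [map_mul, map_mul, ha R g h hh, hb R g h hh]
  add_mem' := fun ha hb R _ _ g h hh => by rw [map_add, map_add, ha R g h hh, hb R g h hh]
  algebraMap_mem' := fun r R _ _ g h _ => by rw [AlgHom.commutes, AlgHom.commutes]

/-- The coordinate ring of the algebraic group `(G_m)^a × (G_a)^b`. -/
abbrev TorusVectorCoord (k : Type u) [Field k] (a b : ℕ) : Type u :=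
  Localization.Away
    (∏ i : Fin a, (MvPolynomial.X (Sum.inl i) : MvPolynomial (Fin a ⊕ Fin b) k))

/-- The `s`-th coordinate function on `(G_m)^a × (G_a)^b`. -/
def torusVectorCoord (k : Type u) [Field k] (a b : ℕ) (s : Fin a ⊕ Fin b) :
    TorusVectorCoord k a b :=
  algebraMap (MvPolynomial (Fin a ⊕ Fin b) k) _ (MvPolynomial.X s)

/-- `𝒥 ≅ (G_m)^a × (G_a)^b` as algebraic groups over `k`. The group law of `𝒥` is the one for
which `G → 𝒥` is a homomorphism, so an isomorphism of varieties `𝒥 ≅ (G_m)^a × (G_a)^b` is a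
homomorphism iff its composite with `G → 𝒥` is multiplicative in the `G_m`-coordinates and
additive in the `G_a`-coordinates. -/
def JacIso (a b : ℕ) : Prop :=
  ∃ e : TorusVectorCoord k a b ≃ₐ[k] jacCoord O,
    ∀ (R : Type u) [CommRing R] [Algebra k R] (g h : UnitCoord O →ₐ[k] R),
      (∀ i : Fin a, mulPoint g h (e (torusVectorCoord k a b (Sum.inl i)) : UnitCoord O) =
        g (e (torusVectorCoord k a b (Sum.inl i)) : UnitCoord O) *
          h (e (torusVectorCoord k a b (Sum.inl i)) : UnitCoord O)) ∧
      (∀ j : Fin b, mulPoint g h (e (torusVectorCoord k a b (Sum.inr j)) : UnitCoord O) =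
        g (e (torusVectorCoord k a b (Sum.inr j)) : UnitCoord O) +
          h (e (torusVectorCoord k a b (Sum.inr j)) : UnitCoord O))

/-- The `p`-th coefficient of `t^n μ`, as a function of `μ ∈ G`. -/
def shiftCoord (n : Fin d → ℕ) (p : Pos O) : UnitCoord O :=
  if n p.1 ≤ (p.2 : ℕ) then
    coord O ⟨p.1, (p.2 : ℕ) - n p.1, (Nat.sub_le _ _).trans_lt p.2.2⟩
  else 0

/-- The ideal of the closed subscheme `{μ ∈ G | t^n μ ∈ 𝒪}` of `G`, generated by the linear
conditions on the coefficients of an element of `𝒪~` (modulo `ℱ ⊆ 𝒪`) that describe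
membership in `𝒪`. -/
def shiftIdeal (n : Fin d → ℕ) : Ideal (UnitCoord O) :=
  Ideal.span {f | ∃ l : Pos O → k,
    (∀ z ∈ O, ∑ p : Pos O, l p * PowerSeries.coeff (p.2 : ℕ) (z p.1) = 0) ∧
      f = ∑ p : Pos O, l p • shiftCoord O n p}

/-- The class `[ℐ_n]`. The set `ℐ_n` of principal ideals `t^n μ 𝒪 ⊆ 𝒪`, `μ ∈ 𝒪~ˣ`, is identified
with the closed subvariety `{μ ∈ 𝒥 | t^n μ ∈ 𝒪}` of `𝒥`, the image in `𝒥` of the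
closed subscheme `{μ | t^n μ ∈ 𝒪}` of `G`. -/
def idealsClass (n : Fin d → ℕ) : K0 k :=
  affineClass (k := k) (jacCoord O ⧸ (shiftIdeal O n).comap (jacCoord O).val)

open Classical in
/-- The zeta function `Z(T₁, …, T_d, 𝒪) = ∑_{n ∈ S} [ℐ_n] 𝕃^{-‖n‖} T^n ∈ ℳ_k⟦T₁, …, T_d⟧`. -/
def zeta : MvPowerSeries (Fin d) (MotivicRing k) := fun n =>
  if (n : Fin d → ℕ) ∈ valueSemigroup O then
    algebraMap (K0 k) (MotivicRing k) (idealsClass O n) *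
      (((lefschetzUnit k)⁻¹ ^ (∑ i, n i) : (MotivicRing k)ˣ) : MotivicRing k)
  else 0

end LocalTheory

/-! ## Algebraic curves and their completed local rings -/

section Curves

variable {k : Type u} [Field k] {Y : Scheme.{u}}

/-- An integral scheme `Y` is an algebraic curve over `k`: it is complete, geometrically
irreducible, and of dimension one. -/
structure IsAlgebraicCurve [IsIntegral Y] (f : Y ⟶ Spec (CommRingCat.of k)) : Prop where
  isProper : IsProper f
  geometricallyIrreducible : GeometricallyIrreducible f
  dim_eq_one : topologicalKrullDim Y = 1

/-- The scalars `k → O_P`. -/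
def scalar (f : Y ⟶ Spec (CommRingCat.of k)) (P : Y) : k →+* Y.presheaf.stalk P :=
  ((Scheme.ΓSpecIso (CommRingCat.of k)).inv ≫ f.appTop ≫ Y.presheaf.germ ⊤ P trivial).hom

variable [IsIntegral Y]

/-- The integral closure `𝕆_P` of `O_P` in the function field. -/
abbrev IntClosure (P : Y) : Type u :=
  integralClosure (Y.presheaf.stalk P) Y.functionField

/-- The completion `Ô_P` of `O_P`. -/
abbrev Compl (P : Y) : Type u :=
  AdicCompletion (IsLocalRing.maximalIdeal (Y.presheaf.stalk P)) (Y.presheaf.stalk P)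

/-- The completion of `𝕆_P` with respect to its Jacobson ideal. -/
abbrev IntClosureCompl (P : Y) : Type u :=
  AdicCompletion (Ideal.jacobson (⊥ : Ideal (IntClosure P))) (IntClosure P)

lemma maximalIdeal_le_comap (P : Y) :
    IsLocalRing.maximalIdeal (Y.presheaf.stalk P) ≤
      (Ideal.jacobson (⊥ : Ideal (IntClosure P))).comap
        (algebraMap (Y.presheaf.stalk P) (IntClosure P)) := by
  intro x hx
  rw [Ideal.mem_comap, Ideal.jacobson, Ideal.mem_sInf]
  rintro M ⟨-, hM⟩
  have := Ideal.isMaximal_comap_of_isIntegral_of_isMaximal (R := Y.presheaf.stalk P) M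
  rw [← Ideal.mem_comap, IsLocalRing.eq_maximalIdeal this]
  exact hx

lemma maximalIdeal_pow_le_comap (P : Y) (n : ℕ) :
    IsLocalRing.maximalIdeal (Y.presheaf.stalk P) ^ n ≤
      (Ideal.jacobson (⊥ : Ideal (IntClosure P)) ^ n).comap
        (algebraMap (Y.presheaf.stalk P) (IntClosure P)) :=
  (Ideal.pow_right_mono (maximalIdeal_le_comap P) n).trans (Ideal.le_comap_pow _ n)

/-- The map `Ô_P → 𝕆_P / 𝔯ⁿ` induced by `O_P ⊆ 𝕆_P`, where `𝔯` is the Jacobson ideal. -/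
def complMapLevel (P : Y) (n : ℕ) :
    Compl P →+* IntClosure P ⧸ Ideal.jacobson (⊥ : Ideal (IntClosure P)) ^ n :=
  (Ideal.quotientMap _ (algebraMap (Y.presheaf.stalk P) (IntClosure P))
    (maximalIdeal_pow_le_comap P n)).comp
    (AdicCompletion.evalₐ (IsLocalRing.maximalIdeal (Y.presheaf.stalk P)) n :
      Compl P →+* Y.presheaf.stalk P ⧸ IsLocalRing.maximalIdeal (Y.presheaf.stalk P) ^ n)

lemma complMapLevel_mk (P : Y) (n : ℕ)
    (y : AdicCompletion.AdicCauchySequence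
      (IsLocalRing.maximalIdeal (Y.presheaf.stalk P)) (Y.presheaf.stalk P)) :
    complMapLevel P n (AdicCompletion.mk _ _ y) =
      Ideal.Quotient.mk _ (algebraMap (Y.presheaf.stalk P) (IntClosure P) (y.val n)) := by
  rw [complMapLevel, RingHom.comp_apply, RingHom.coe_coe, AdicCompletion.evalₐ_mk,
    Ideal.quotientMap_mk]

lemma complMapLevel_comp (P : Y) {m n : ℕ} (hle : m ≤ n) :
    (Ideal.Quotient.factorPow _ hle).comp (complMapLevel P n) = complMapLevel P m := by
  refine RingHom.ext fun x => ?_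
  obtain ⟨y, rfl⟩ := AdicCompletion.mk_surjective _ _ x
  rw [RingHom.comp_apply, complMapLevel_mk, complMapLevel_mk]
  have h := y.property hle
  rw [SModEq.sub_mem] at h
  have h' : y.val n - y.val m ∈ IsLocalRing.maximalIdeal (Y.presheaf.stalk P) ^ m := by
    rw [← neg_sub]
    exact neg_mem (by simpa using h)
  have h2 := maximalIdeal_pow_le_comap P m h'
  rw [Ideal.mem_comap, map_sub] at h2
  exact Ideal.Quotient.eq.2 h2

/-- The map from `Ô_P` to the completion of `𝕆_P` induced by `O_P ⊆ 𝕆_P`. -/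
def complMap (P : Y) : Compl P →+* IntClosureCompl P :=
  AdicCompletion.liftRingHom (Ideal.jacobson (⊥ : Ideal (IntClosure P)))
    (complMapLevel P) (complMapLevel_comp P)

lemma complMap_algebraMap (P : Y) (a : Y.presheaf.stalk P) :
    complMap P (algebraMap _ (Compl P) a) =
      algebraMap (IntClosure P) (IntClosureCompl P)
        (algebraMap (Y.presheaf.stalk P) (IntClosure P) a) := by
  refine AdicCompletion.ext_evalₐ fun n => ?_
  rw [complMap, AdicCompletion.evalₐ_liftRingHom _ _ (complMapLevel_comp P), AlgHom.commutes,
    complMapLevel, RingHom.comp_apply, RingHom.coe_coe, AlgHom.commutes]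
  rfl

/-- `P` is a singular point: `O_P` is not regular. -/
def IsSingular (P : Y) : Prop := ¬ IsRegularLocalRing (Y.presheaf.stalk P)

/-- `Ô_P` is totally rational: the points of the normalization over `P`, i.e. the maximal ideals
of `𝕆_P`, all have residue field `k`. -/
def IsTotallyRational (f : Y ⟶ Spec (CommRingCat.of k)) (P : Y) : Prop :=
  ∀ Q : Ideal (IntClosure P), Q.IsMaximal →
    Function.Bijective (((Ideal.Quotient.mk Q).comp
      (algebraMap (Y.presheaf.stalk P) (IntClosure P))).comp (scalar f P))

/-- An identification of the completion of `𝕆_P` with `k⟦t₁⟧ × ⋯ × k⟦t_d⟧` over `k`, i.e. a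
numbering of the branches and a choice of uniformizers. -/
structure Parametrization (f : Y ⟶ Spec (CommRingCat.of k)) (P : Y) (d : ℕ) where
  /-- the isomorphism -/
  equiv : IntClosureCompl P ≃+* (Fin d → k⟦X⟧)
  /-- compatibility with the scalars -/
  map_scalar : ∀ a : k,
    equiv (algebraMap (IntClosure P) (IntClosureCompl P)
      (algebraMap (Y.presheaf.stalk P) (IntClosure P) (scalar f P a))) =
    algebraMap k (Fin d → k⟦X⟧) a

/-- The ring `Ô_P`, identified with its image in `k⟦t₁⟧ × ⋯ × k⟦t_d⟧`. -/
def Parametrization.localRing {f : Y ⟶ Spec (CommRingCat.of k)} {P : Y} {d : ℕ}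
    (φ : Parametrization f P d) : Subalgebra k (Fin d → k⟦X⟧) where
  __ := (φ.equiv.toRingHom.comp (complMap P)).range
  algebraMap_mem' := fun a => ⟨algebraMap _ (Compl P) (scalar f P a), by
    rw [← φ.map_scalar a, ← complMap_algebraMap]
    rfl⟩

/-- `k` is big enough for `Y`: at every singular point `P` of `Y` the ring `Ô_P` is totally
rational and `𝒥 ≅ (G_m)^{d-1} × (G_a)^{δ-d+1}`. -/
def IsBigEnough (f : Y ⟶ Spec (CommRingCat.of k)) : Prop :=
  ∀ P : Y, IsSingular P → IsTotallyRational f P ∧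
    ∀ (d : ℕ) (φ : Parametrization f P d),
      JacIso φ.localRing (d - 1) (singularityDegree φ.localRing + 1 - d)

end Curves

end CurveZeta

end

/-! Everything takes place in the finite-dimensional space `𝒪~/ℱ`, with coordinates at the positions
`(i, j)`, `j < c_i`, ordered with smaller exponents first. The leading positions of a subspace,
where its elements have their first nonzero coordinate, are as many as its dimension. Let `G =
𝒪~ˣ/(1+ℱ)`, `H = 𝒪ˣ/(1+ℱ)` and let `p₀` be the first position.

Each coset `μH` contains exactly one point that agrees with `1` at the leading positions of `𝒪/ℱ`:
finding it is a triangular linear system with units on the diagonal (`existsUnique_mulCoeff_eq`). So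
`𝒥`, defined through invariant functions, is the slice of normal forms in `G`, and `ℐ_n` is the set
of normal forms `ν` with `t^n ν ∈ 𝒪` (`IsNormalizer.isUniversal_normalPoints`). The `h ∈ H` with
`h_{p₀} = 1` form an affine space of dimension `dim 𝒪/ℱ - 1`, and `(ν, h) ↦ νh` is an isomorphism
onto the `w` with `t^n w ∈ 𝒪`, `w_{p₀} = 1` and invertible constant coefficients
(`isUniversal_tensor`). This is the complement of coordinate hyperplanes in an affine space, so
inclusion-exclusion expresses its class by dimensions of intersections. Hence `[ℐ_n] 𝕃^(dim 𝒪/ℱ -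
1)` is an explicit integral polynomial in `𝕃` (`HasEqualConst.idealsClass_mul`), and `𝕃` is
invertible in `ℳ_k`. The dimensions depend on `S` alone, since being a leading position is a
statement about values (`HasConductor.mem_leading_iff`).

Two facts about `𝒪` are needed: the components of an element share their constant coefficient, and
`𝒪` contains some `t^N 𝒪~`, hence `ℱ`. A parametrization is only a ring isomorphism, so the adic and
the `t`-adic topologies have to be compared before these follow. -/

noncomputable section

namespace CurveZeta

/-! ### Classes of affine varieties in the Grothendieck ring. -/

section AffineClasses

variable {k : Type u} [Field k]

open TensorProduct

variable (k) in
/-- The affine variety `Spec A`, for a finitely generated `k`-algebra `A`. -/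
def Variety.affine (A : Type u) [CommRing A] [Algebra k A] [h : Algebra.FiniteType k A] :
    Variety.{u} k where
  X := Spec (CommRingCat.of A)
  hom := Spec.map (CommRingCat.ofHom (algebraMap k A))
  locallyOfFiniteType := by
    rw [HasRingHomProperty.Spec_iff (P := @LocallyOfFiniteType)]
    simpa [RingHom.finiteType_algebraMap] using h
  quasiCompact := inferInstance
  isSeparated := inferInstance

lemma affineClass_eq (A : Type u) [CommRing A] [Algebra k A] [Algebra.FiniteType k A] :
    affineClass (k := k) A =
      Ideal.Quotient.mk _ (FreeCommRing.of (Variety.affine k A)) := by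
  rw [affineClass, classOf, dif_pos ⟨(Variety.affine k A).locallyOfFiniteType,
    (Variety.affine k A).quasiCompact, (Variety.affine k A).isSeparated⟩]
  rfl

lemma K0.mk_eq_of_rel {x y : FreeCommRing (Variety.{u} k)} (h : GrothendieckRel (x - y)) :
    (Ideal.Quotient.mk (Ideal.span {x | GrothendieckRel x}) x : K0 k) =
      Ideal.Quotient.mk _ y :=
  Ideal.Quotient.eq.2 (Ideal.subset_span h)

lemma affineClass_congr {A B : Type u} [CommRing A] [Algebra k A] [CommRing B] [Algebra k B]
    [Algebra.FiniteType k A] (e : A ≃ₐ[k] B) :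
    affineClass (k := k) A = affineClass (k := k) B := by
  have : Algebra.FiniteType k B := .equiv ‹_› e
  rw [affineClass_eq, affineClass_eq]
  refine K0.mk_eq_of_rel (.iso _ _ (Scheme.Spec.mapIso e.toRingEquiv.toCommRingCatIso.op).symm ?_)
  change Spec.map e.toRingEquiv.toCommRingCatIso.inv ≫
    Spec.map (CommRingCat.ofHom (algebraMap k B)) = Spec.map (CommRingCat.ofHom (algebraMap k A))
  rw [← Spec.map_comp]
  congr 1
  ext x
  exact e.symm.commutes x

lemma affineClass_scissors (A : Type u) [CommRing A] [Algebra k A] [Algebra.FiniteType k A]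
    (f : A) : affineClass (k := k) A =
      affineClass (k := k) (Localization.Away f) + affineClass (k := k) (A ⧸ Ideal.span {f}) := by
  have : Algebra.FiniteType A (Localization.Away f) :=
    IsLocalization.finiteType_of_monoid_fg (.powers f) _
  have : Algebra.FiniteType k (Localization.Away f) := .trans ‹_› this
  rw [affineClass_eq, affineClass_eq, affineClass_eq, ← map_add]
  refine K0.mk_eq_of_rel (.scissors _ _ _
    (Spec.map (CommRingCat.ofHom (Ideal.Quotient.mk (Ideal.span {f}))))
    (Spec.map (CommRingCat.ofHom (algebraMap A (Localization.Away f)))) ?_ ?_ ?_ ?_ ?_)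
  · exact (Spec.map_comp _ _).symm
  · refine (Spec.map_comp _ _).symm.trans ?_
    change _ = Spec.map (CommRingCat.ofHom (algebraMap k (Localization.Away f)))
    rw [IsScalarTower.algebraMap_eq k A (Localization.Away f)]
    rfl
  · exact IsClosedImmersion.spec_of_surjective
      (CommRingCat.ofHom (Ideal.Quotient.mk (Ideal.span {f}))) Ideal.Quotient.mk_surjective
  · exact inferInstanceAs (IsOpenImmersion
      (Spec.map (CommRingCat.ofHom (algebraMap A (Localization.Away f)))))
  · refine (PrimeSpectrum.localization_away_comap_range (Localization.Away f) f).trans ?_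
    refine Eq.trans ?_ (congrArg _ (range_comap_of_surjective _
      (Ideal.Quotient.mk (Ideal.span {f})) Ideal.Quotient.mk_surjective).symm)
    rw [Ideal.mk_ker, PrimeSpectrum.zeroLocus_span, PrimeSpectrum.basicOpen_eq_zeroLocus_compl]
    rfl

lemma affineClass_tensor (A B : Type u) [CommRing A] [Algebra k A] [Algebra.FiniteType k A]
    [CommRing B] [Algebra k B] [Algebra.FiniteType k B] :
    affineClass (k := k) (A ⊗[k] B) = affineClass (k := k) A * affineClass (k := k) B := by
  have : Algebra.FiniteType A (A ⊗[k] B) := inferInstance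
  have : Algebra.FiniteType k (A ⊗[k] B) := .trans (S := A) ‹_› this
  rw [affineClass_eq, affineClass_eq, affineClass_eq, ← map_mul]
  refine K0.mk_eq_of_rel (.prod _ _ _
    (Spec.map (CommRingCat.ofHom Algebra.TensorProduct.includeLeftRingHom))
    (Spec.map (CommRingCat.ofHom (Algebra.TensorProduct.includeRight (R := k) (A := A)
      (B := B)).toRingHom)) ?_ ?_)
  · exact (Spec.map_comp _ _).symm
  · exact isPullback_SpecMap_of_isPushout _ _ _ _ (CommRingCat.isPushout_tensorProduct k A B)

lemma affineClass_self : affineClass (k := k) k = 1 := by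
  rw [affineClass_eq, ← map_one (Ideal.Quotient.mk _)]
  refine K0.mk_eq_of_rel (.point _ ?_)
  change IsIso (Spec.map (𝟙 _))
  infer_instance

/-- Scissors along `f = 0`: the closed and the open piece are both isomorphic to `Spec A`, so its
class is twice itself. -/
lemma affineClass_of_subsingleton (A : Type u) [CommRing A] [Algebra k A] [Subsingleton A] :
    affineClass (k := k) A = 0 := by
  have : Algebra.FiniteType k A := .of_surjective (Algebra.ofId k A)
    fun x => ⟨0, Subsingleton.elim _ _⟩
  have h := affineClass_scissors (k := k) A 0
  have : Subsingleton (Localization.Away (0 : A)) :=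
    (algebraMap A (Localization.Away (0 : A))).codomain_trivial
  let e : A ≃ₐ[k] Localization.Away (0 : A) :=
    .ofBijective (IsScalarTower.toAlgHom k A _)
      ⟨fun _ _ _ => Subsingleton.elim _ _, fun x => ⟨0, Subsingleton.elim _ _⟩⟩
  let e' : A ≃ₐ[k] A ⧸ Ideal.span {(0 : A)} :=
    .ofBijective (Ideal.Quotient.mkₐ k _)
      ⟨fun _ _ _ => Subsingleton.elim _ _, Ideal.Quotient.mk_surjective⟩
  rw [← affineClass_congr e, ← affineClass_congr e'] at h
  simpa using h

lemma affineClass_mvPolynomial (σ : Type) [Finite σ] :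
    affineClass (k := k) (MvPolynomial σ k) = lefschetz k ^ Nat.card σ := by
  obtain ⟨n, ⟨e⟩⟩ := Finite.exists_equiv_fin σ
  rw [affineClass_congr (MvPolynomial.renameEquiv k e), Nat.card_congr e, Nat.card_fin]
  clear e
  induction n with
  | zero => rw [affineClass_congr (MvPolynomial.isEmptyAlgEquiv k _), affineClass_self, pow_zero]
  | succ n ih =>
    rw [affineClass_congr ((MvPolynomial.finSuccEquiv k n).trans
      ((polyEquivTensor k (MvPolynomial (Fin n) k)).restrictScalars k)), affineClass_tensor, ih,
      pow_succ]
    rfl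

end AffineClasses

/-! ### Echelon bases and base change of subspaces. -/

section LinearAlgebra

open Matrix

/-- The determinant is a product of units. Used over `k` for echelon bases and over arbitrary
`k`-algebras for normal forms. -/
lemma bijective_mulVec_of_triangular {ι R : Type*} [Fintype ι] [CommRing R] {r : ι → ℕ}
    (hr : Function.Injective r) (M : Matrix ι ι R) (h0 : ∀ p q, r q < r p → M q p = 0)
    (hd : ∀ p, IsUnit (M p p)) : Function.Bijective (M *ᵥ ·) := by
  classical
  let _ : LinearOrder ι := LinearOrder.lift' r hr
  have hdet : IsUnit M.det := by
    rw [det_of_isLowerTriangular M fun p q (h : OrderDual.toDual q < OrderDual.toDual p) => ?_]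
    · exact (IsUnit.prod_iff (M := R)).2 fun p _ => hd p
    · exact h0 q p h
  refine ⟨fun x y h => ?_, fun y => ⟨M⁻¹ *ᵥ y, by simp [Matrix.mul_nonsing_inv M hdet]⟩⟩
  simpa [Matrix.nonsing_inv_mul M hdet] using congrArg (M⁻¹ *ᵥ ·) h

variable {k : Type u} [Field k] {P : Type} {r : P → ℕ}

/-- The positions, in the order given by `r`, of the first nonzero coordinates of the elements
of `V`. -/
def leading (r : P → ℕ) (V : Submodule k (P → k)) : Set P :=
  {p | ∃ v ∈ V, v p ≠ 0 ∧ ∀ q, r q < r p → v q = 0}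

instance [Finite P] (V : Submodule k (P → k)) : Fintype (leading r V) := Fintype.ofFinite _

/-- The family `b` is the reduced echelon basis of `V`. -/
structure IsReducedBasis [Fintype P] (r : P → ℕ) (V : Submodule k (P → k))
    (b : leading r V → P → k) : Prop where
  mem : ∀ p, b p ∈ V
  self : ∀ p, b p p = 1
  ne : ∀ p q : leading r V, q ≠ p → b p q = 0
  lt : ∀ (p : leading r V) (q : P), r q < r p → b p q = 0
  sum : ∀ v ∈ V, ∀ q, v q = ∑ p : leading r V, v p * b p q

lemma exists_leading_of_ne_zero [Fintype P] (V : Submodule k (P → k)) {v : P → k} (hv : v ∈ V)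
    (h : v ≠ 0) : ∃ p : leading r V, v p ≠ 0 ∧ ∀ q, r q < r p → v q = 0 := by
  obtain ⟨p, hp, hmin⟩ := (Set.toFinite {p | v p ≠ 0}).exists_minimalFor r _
    (Function.ne_iff.1 h)
  have h' : ∀ q, r q < r p → v q = 0 := fun q hq => by
    by_contra hne
    exact absurd (hmin hne hq.le) (not_le.2 hq)
  exact ⟨⟨p, v, hv, hp, h'⟩, hp, h'⟩

/-- Elements of `V` chosen one for each leading position form a triangular matrix there, which can
be inverted. They span, because an element of `V` vanishing at all leading positions is zero. -/
lemma exists_isReducedBasis [Fintype P] (hr : Function.Injective r) (V : Submodule k (P → k)) :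
    ∃ b, IsReducedBasis r V b := by
  classical
  have hzero : ∀ v ∈ V, (∀ p : leading r V, v p = 0) → v = 0 := fun v hv h => by
    by_contra hne
    obtain ⟨p, hp, -⟩ := exists_leading_of_ne_zero (r := r) V hv hne
    exact hp (h p)
  choose e heV hep hlt using fun p : leading r V => p.2
  have hbij := bijective_mulVec_of_triangular (r := fun p : leading r V => r p)
    (hr.comp Subtype.val_injective) (Matrix.of fun q p : leading r V => e p q)
    (fun p q h => hlt p q h) (fun p => (hep p).isUnit)
  choose x hx using fun p : leading r V => hbij.2 (Pi.single p 1)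
  let b : leading r V → P → k := fun p => ∑ s, x p s • e s
  have hbV : ∀ p, b p ∈ V := fun p => V.sum_mem fun s _ => V.smul_mem _ (heV s)
  have hb : ∀ p q : leading r V, b p q = if q = p then 1 else 0 := fun p q => by
    have := congrFun (hx p) q
    rw [Pi.single_apply] at this
    rw [← this]
    simp [b, Matrix.mulVec, dotProduct, mul_comm]
  refine ⟨b, hbV, fun p => by simp [hb], fun p q h => by simp [hb, h], fun p q hq => ?_,
    fun v hv q => ?_⟩
  · have hne : b p ≠ 0 := fun h => by simpa [h] using hb p p
    obtain ⟨s, hs, hmin⟩ := exists_leading_of_ne_zero (r := r) V (hbV p) hne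
    have : s = p := by
      by_contra h
      simp [hb, h] at hs
    exact hmin q (this ▸ hq)
  · have := hzero (v - ∑ p : leading r V, v p • b p)
      (V.sub_mem hv (V.sum_mem fun s _ => V.smul_mem _ (hbV s)))
      (fun p => by simp [hb])
    have := congrFun (sub_eq_zero.1 this) q
    simpa using this

variable (R : Type u) [CommRing R] [Algebra k R]

/-- The `R`-span of a subspace `V` of a coordinate space over `k`. -/
def baseSpan (V : Submodule k (P → k)) : Submodule R (P → R) :=
  Submodule.span R {w | ∃ v ∈ V, w = fun p => algebraMap k R (v p)}

variable {R}

lemma mem_baseSpan {V : Submodule k (P → k)} {v : P → k} (hv : v ∈ V) :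
    (fun p => algebraMap k R (v p)) ∈ baseSpan R V :=
  Submodule.subset_span ⟨v, hv, rfl⟩

/-- The identity is linear with coefficients in `k`, so it survives base change: over every `R` the
span is a graph over the leading coordinates. -/
lemma IsReducedBasis.mem_baseSpan_iff [Fintype P] {V : Submodule k (P → k)}
    {b : leading r V → P → k} (hb : IsReducedBasis r V b) {w : P → R} :
    w ∈ baseSpan R V ↔ ∀ q, w q = ∑ p : leading r V, w p * algebraMap k R (b p q) := by
  constructor
  · intro h
    induction h using Submodule.span_induction with
    | mem w hw =>
      obtain ⟨v, hv, rfl⟩ := hw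
      intro q
      simp_rw [← map_mul, ← map_sum, ← hb.sum v hv q]
    | zero => simp
    | add x y _ _ hx hy =>
      intro q
      simp only [Pi.add_apply, add_mul, Finset.sum_add_distrib]
      rw [← hx, ← hy]
    | smul a x _ hx =>
      intro q
      simp only [Pi.smul_apply, smul_eq_mul, mul_assoc, ← Finset.mul_sum]
      rw [← hx]
  · intro h
    have : w = ∑ p : leading r V, w p • fun q => algebraMap k R (b p q) := by
      ext q
      simpa using h q
    rw [this]
    exact Submodule.sum_mem _ fun p _ => Submodule.smul_mem _ _ (mem_baseSpan (hb.mem p))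

lemma IsReducedBasis.sum_mem_baseSpan [Fintype P] {V : Submodule k (P → k)}
    {b : leading r V → P → k} (hb : IsReducedBasis r V b) (x : leading r V → R) :
    (fun q => ∑ p, x p * algebraMap k R (b p q)) ∈ baseSpan R V := by
  have : (fun q => ∑ p, x p * algebraMap k R (b p q)) =
      ∑ p : leading r V, x p • fun q => algebraMap k R (b p q) := by
    ext q
    simp
  rw [this]
  exact Submodule.sum_mem _ fun p _ => Submodule.smul_mem _ _ (mem_baseSpan (hb.mem p))

lemma IsReducedBasis.sum_apply [Fintype P] {V : Submodule k (P → k)}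
    {b : leading r V → P → k} (hb : IsReducedBasis r V b) (x : leading r V → R)
    (q : leading r V) : ∑ p, x p * algebraMap k R (b p q) = x q := by
  classical
  rw [Finset.sum_eq_single q (fun p _ h => by simp [hb.ne p q h.symm]) (by simp)]
  simp [hb.self]

lemma IsReducedBasis.ext [Fintype P] {V : Submodule k (P → k)}
    {b : leading r V → P → k} (hb : IsReducedBasis r V b) {w w' : P → R}
    (hw : w ∈ baseSpan R V) (hw' : w' ∈ baseSpan R V) (h : ∀ p : leading r V, w p = w' p) :
    w = w' := by
  ext q
  rw [hb.mem_baseSpan_iff.1 hw q, hb.mem_baseSpan_iff.1 hw' q]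
  simp_rw [h]

/-- The linear equations of `V` cut out its `R`-span. -/
lemma mem_baseSpan_iff_forall [Fintype P] {V : Submodule k (P → k)} {w : P → R} :
    w ∈ baseSpan R V ↔
      ∀ l : P → k, (∀ v ∈ V, ∑ p, l p * v p = 0) → ∑ p, l p • w p = 0 := by
  classical
  constructor
  · intro h l hl
    induction h using Submodule.span_induction with
    | mem w hw =>
      obtain ⟨v, hv, rfl⟩ := hw
      simp_rw [Algebra.smul_def, ← map_mul, ← map_sum, hl v hv, map_zero]
    | zero => simp
    | add x y _ _ hx hy => simp [smul_add, Finset.sum_add_distrib, hx, hy]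
    | smul a x _ hx =>
      simp only [Pi.smul_apply, smul_comm _ a, ← Finset.smul_sum, hx, smul_zero]
  · intro h
    obtain ⟨e⟩ := Fintype.truncEquivFin P
    have hr : Function.Injective fun p => (e p : ℕ) := Fin.val_injective.comp e.injective
    obtain ⟨b, hb⟩ := exists_isReducedBasis hr V
    refine hb.mem_baseSpan_iff.2 fun q => ?_
    -- The functional used for `l` is `v ↦ v q - ∑ v p * b p q`, which vanishes on `V` because `b`
    -- is a reduced basis.
    have key : ∀ (f : P → R), ∑ p, (Pi.single q 1 - fun s => ∑ p : leading _ V,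
        b p q * if (p : P) = s then 1 else 0 : P → k) p • f p =
        f q - ∑ p : leading _ V, f p * algebraMap k R (b p q) := fun f => by
      simp only [Pi.sub_apply, sub_smul, Finset.sum_sub_distrib, Finset.sum_smul]
      rw [Finset.sum_comm]
      simp [Pi.single_apply, Algebra.smul_def, mul_comm, apply_ite (algebraMap k R)]
    rw [← sub_eq_zero, ← key]
    refine h _ fun v hv => ?_
    simp only [Pi.sub_apply, sub_mul, Finset.sum_sub_distrib, Finset.sum_mul]
    rw [Finset.sum_comm, sub_eq_zero]
    simpa [Pi.single_apply, mul_comm] using hb.sum v hv q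

lemma baseSpan_map {V : Submodule k (P → k)} {S : Type u} [CommRing S] [Algebra k S]
    (φ : R →ₐ[k] S) {w : P → R} (hw : w ∈ baseSpan R V) : (fun p => φ (w p)) ∈ baseSpan S V := by
  induction hw using Submodule.span_induction with
  | mem w hw =>
    obtain ⟨v, hv, rfl⟩ := hw
    simpa using mem_baseSpan hv
  | zero =>
    simp only [Pi.zero_apply, map_zero]
    exact Submodule.zero_mem _
  | add x y _ _ hx hy => simpa using! Submodule.add_mem _ hx hy
  | smul a x _ hx => simpa using! Submodule.smul_mem _ (φ a) hx

/-- The elements of `V` whose coordinate at `p` vanishes. -/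
def kerAt (V : Submodule k (P → k)) (p : P) : Submodule k (P → k) :=
  V ⊓ LinearMap.ker (LinearMap.proj (R := k) (φ := fun _ : P => k) p)

lemma mem_kerAt {V : Submodule k (P → k)} {p : P} {v : P → k} :
    v ∈ kerAt V p ↔ v ∈ V ∧ v p = 0 := by
  simp [kerAt]

/-- Intersecting with a coordinate hyperplane commutes with base change, as every equation of the
intersection is an equation of `V` plus a multiple of the `p`-th coordinate. -/
lemma mem_baseSpan_kerAt [Fintype P] {V : Submodule k (P → k)} {p : P} {w : P → R} :
    w ∈ baseSpan R (kerAt V p) ↔ w ∈ baseSpan R V ∧ w p = 0 := by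
  classical
  simp only [mem_baseSpan_iff_forall, mem_kerAt]
  constructor
  · refine fun h => ⟨fun l hl => h l fun v hv => hl v hv.1, ?_⟩
    simpa [Pi.single_apply] using h (Pi.single p 1) fun v hv => by simp [Pi.single_apply, hv.2]
  · rintro ⟨h, hp⟩ l hl
    by_cases hV : ∃ v ∈ V, v p ≠ 0
    · obtain ⟨v, hv, hvp⟩ := hV
      -- This `a` makes `l - a e_p` vanish at `v`; as `V = kerAt V p + k v`, it then vanishes on
      -- `V`.
      set a := (v p)⁻¹ * ∑ q, l q * v q with ha
      have := h (l - Pi.single p a) fun x hx => by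
        have := hl (x - (x p * (v p)⁻¹) • v)
          ⟨V.sub_mem hx (V.smul_mem _ hv), by simp [hvp]⟩
        simp only [Pi.sub_apply, Pi.smul_apply, smul_eq_mul, mul_sub, Finset.sum_sub_distrib] at this
        simp only [Pi.sub_apply, sub_mul, Finset.sum_sub_distrib, Pi.single_apply, ite_mul, zero_mul,
          Finset.sum_ite_eq', Finset.mem_univ, if_true]
        rw [← this, ha, mul_right_comm, Finset.mul_sum]
        congr 1
        exact Finset.sum_congr rfl fun q _ => by ring
      simpa [sub_smul, Finset.sum_sub_distrib, Pi.single_apply, ite_smul, hp] using this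
    · push Not at hV
      exact h l fun v hv => hl v ⟨hv, hV v hv⟩

/-- The elements of `V` whose coordinates at the positions in `J` vanish. -/
def kerOn (V : Submodule k (P → k)) (J : Finset P) : Submodule k (P → k) where
  carrier := {v | v ∈ V ∧ ∀ p ∈ J, v p = 0}
  zero_mem' := ⟨V.zero_mem, fun _ _ => rfl⟩
  add_mem' h h' := ⟨V.add_mem h.1 h'.1, fun p hp => by simp [h.2 p hp, h'.2 p hp]⟩
  smul_mem' a _ h := ⟨V.smul_mem a h.1, fun p hp => by simp [h.2 p hp]⟩

lemma mem_kerOn {V : Submodule k (P → k)} {J : Finset P} {v : P → k} :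
    v ∈ kerOn V J ↔ v ∈ V ∧ ∀ p ∈ J, v p = 0 :=
  Iff.rfl

lemma kerOn_empty (V : Submodule k (P → k)) : kerOn V ∅ = V := by
  ext v
  simp [mem_kerOn]

lemma kerOn_insert [DecidableEq P] (V : Submodule k (P → k)) (p : P) (J : Finset P) :
    kerOn V (insert p J) = kerOn (kerAt V p) J := by
  ext v
  simp [mem_kerOn, mem_kerAt, and_assoc]

end LinearAlgebra

/-! ### Functors of tuples and complements of hyperplane arrangements. -/

section Representability

variable {k : Type u} [Field k] {P : Type}

/-- The `k`-algebra `A` with the point `u` represents the functor `F` of sets of tuples. -/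
structure IsUniversal (F : ∀ (R : Type u) [CommRing R] [Algebra k R], Set (P → R))
    (A : Type u) [CommRing A] [Algebra k A] (u : P → A) : Prop where
  map_mem : ∀ {R : Type u} [CommRing R] [Algebra k R] (φ : A →ₐ[k] R), (fun p => φ (u p)) ∈ F R
  lift : ∀ {R : Type u} [CommRing R] [Algebra k R] (w : P → R), w ∈ F R →
    ∃ φ : A →ₐ[k] R, ∀ p, φ (u p) = w p
  ext : ∀ {R : Type u} [CommRing R] [Algebra k R] (φ ψ : A →ₐ[k] R),
    (∀ p, φ (u p) = ψ (u p)) → φ = ψ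

variable {F G : ∀ (R : Type u) [CommRing R] [Algebra k R], Set (P → R)}
  {A B : Type u} [CommRing A] [Algebra k A] [CommRing B] [Algebra k B] {u : P → A} {w : P → B}

lemma IsUniversal.mem (h : IsUniversal F A u) : u ∈ F A := h.map_mem (AlgHom.id k A)

lemma IsUniversal.congr (h : IsUniversal F A u)
    (H : ∀ (R : Type u) [CommRing R] [Algebra k R] (x : P → R), x ∈ F R ↔ x ∈ G R) :
    IsUniversal G A u where
  map_mem φ := (H _ _).1 (h.map_mem φ)
  lift w hw := h.lift w ((H _ _).2 hw)
  ext := h.ext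

lemma IsUniversal.nonempty_algEquiv (h : IsUniversal F A u) (h' : IsUniversal F B w) :
    Nonempty (A ≃ₐ[k] B) := by
  obtain ⟨φ, hφ⟩ := h.lift w h'.mem
  obtain ⟨ψ, hψ⟩ := h'.lift u h.mem
  exact ⟨.ofAlgHom φ ψ (h'.ext _ _ fun p => by simp [hφ, hψ])
    (h.ext _ _ fun p => by simp [hφ, hψ])⟩

lemma IsUniversal.localization (h : IsUniversal F A u) (p : P) :
    IsUniversal (k := k) (fun R _ _ => {x : P → R | x ∈ F R ∧ IsUnit (x p)}) (Localization.Away (u p))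
      (fun q => algebraMap A _ (u q)) where
  map_mem φ := ⟨h.map_mem (φ.comp (IsScalarTower.toAlgHom k A _)),
    (IsLocalization.Away.algebraMap_isUnit (u p)).map φ⟩
  lift {R} _ _ x hx := by
    obtain ⟨φ, hφ⟩ := h.lift x hx.1
    refine ⟨IsLocalization.liftAlgHom (M := Submonoid.powers (u p)) (f := φ) ?_, fun q => ?_⟩
    · rintro ⟨_, n, rfl⟩
      rw [map_pow, hφ]
      exact hx.2.pow n
    · simp [hφ]
  ext φ ψ H := by
    refine IsLocalization.algHom_ext (Submonoid.powers (u p)) ?_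
    refine h.ext (φ.comp (IsScalarTower.toAlgHom k A _)) (ψ.comp (IsScalarTower.toAlgHom k A _)) H

lemma IsUniversal.quotient (h : IsUniversal F A u) (p : P) :
    IsUniversal (k := k) (fun R _ _ => {x : P → R | x ∈ F R ∧ x p = 0}) (A ⧸ Ideal.span {u p})
      (fun q => Ideal.Quotient.mk _ (u q)) where
  map_mem φ := ⟨h.map_mem (φ.comp (Ideal.Quotient.mkₐ k _)),
    (congrArg φ (Ideal.Quotient.eq_zero_iff_mem.2 (Ideal.mem_span_singleton_self _))).trans
      (map_zero φ)⟩
  lift {R} _ _ x hx := by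
    obtain ⟨φ, hφ⟩ := h.lift x hx.1
    have : ∀ a ∈ Ideal.span {u p}, φ a = 0 := by
      intro a ha
      obtain ⟨b, rfl⟩ := Ideal.mem_span_singleton'.1 ha
      rw [map_mul, hφ, hx.2, mul_zero]
    exact ⟨Ideal.Quotient.liftₐ _ φ this, hφ⟩
  ext φ ψ H := Ideal.Quotient.algHom_ext _ (h.ext (φ.comp (Ideal.Quotient.mkₐ k _))
    (ψ.comp (Ideal.Quotient.mkₐ k _)) H)

/-- The points of the complement, in the affine slice `w p₀ = 1` of a linear space, of the
coordinate hyperplanes for the positions in `T`. -/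
def slicePoints (V : Submodule k (P → k)) (p₀ : P) (T : Finset P) (R : Type u) [CommRing R]
    [Algebra k R] : Set (P → R) :=
  {w | w ∈ baseSpan R V ∧ w p₀ = 1 ∧ ∀ p ∈ T, IsUnit (w p)}

variable [Fintype P] {r : P → ℕ}

/-- The coordinates at the leading positions are free parameters; the one at `p₀` is fixed, the
others are the variables. -/
lemma isUniversal_slicePoints_empty {V : Submodule k (P → k)} {b : leading r V → P → k}
    (hb : IsReducedBasis r V b) {p₀ : P} (hp₀ : p₀ ∈ leading r V) :
    ∃ u : P → MvPolynomial {p : leading r V // (p : P) ≠ p₀} k,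
      IsUniversal (slicePoints V p₀ ∅) (MvPolynomial {p : leading r V // (p : P) ≠ p₀} k) u := by
  classical
  let x : leading r V → MvPolynomial {p : leading r V // (p : P) ≠ p₀} k := fun p =>
    if h : (p : P) = p₀ then 1 else .X ⟨p, h⟩
  let u : P → MvPolynomial {p : leading r V // (p : P) ≠ p₀} k :=
    fun q => ∑ p, x p * algebraMap k _ (b p q)
  have hux : ∀ p : leading r V, u p = x p := fun p => hb.sum_apply x p
  have huV : u ∈ baseSpan _ V := hb.sum_mem_baseSpan x
  have hu0 : u p₀ = 1 := (hux ⟨p₀, hp₀⟩).trans (by simp [x])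
  refine ⟨u, fun φ => ⟨baseSpan_map φ huV, by simp [hu0], by simp⟩, fun w hw => ?_,
    fun φ ψ H => ?_⟩
  · refine ⟨MvPolynomial.aeval fun p => w p, fun q => ?_⟩
    rw [hb.mem_baseSpan_iff.1 hw.1 q]
    simp only [u, map_sum, map_mul, AlgHom.commutes]
    refine Finset.sum_congr rfl fun p _ => ?_
    congr 1
    by_cases h : (p : P) = p₀
    · simp [x, h, hw.2.1]
    · simp [x, h]
  · refine MvPolynomial.algHom_ext fun p => ?_
    have := H p
    rw [hux] at this
    simpa [x, p.2] using this

open Classical in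
/-- The class in `K₀(Var_k)` of `slicePoints V p₀ T`, for `p₀` the first position. -/
def sliceClass (r : P → ℕ) (V : Submodule k (P → k)) (p₀ : P) (T : Finset P) : K0 k :=
  ∑ J ∈ T.powerset, (-1) ^ J.card * if p₀ ∈ leading r (kerOn V J) then
    lefschetz k ^ (Nat.card (leading r (kerOn V J)) - 1) else 0

/-- Deletion and restriction: inverting `u p` adds `p` to `T`, killing it replaces `V` by `kerAt V
p`. Repeated scissors add up to the inclusion-exclusion sum. -/
lemma exists_isUniversal_slicePoints (hr : Function.Injective r) {p₀ : P}
    (hp₀ : ∀ q, r p₀ ≤ r q) (V : Submodule k (P → k)) (T : Finset P) :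
    ∃ (A : Type u) (_ : CommRing A) (_ : Algebra k A) (u : P → A),
      IsUniversal (slicePoints V p₀ T) A u ∧ Algebra.FiniteType k A ∧
        affineClass (k := k) A = sliceClass r V p₀ T := by
  classical
  induction T using Finset.induction_on generalizing V with
  | empty =>
    by_cases h : p₀ ∈ leading r V
    · obtain ⟨b, hb⟩ := exists_isReducedBasis hr V
      obtain ⟨u, hu⟩ := isUniversal_slicePoints_empty hb h
      refine ⟨_, _, _, u, hu, inferInstance, ?_⟩
      have hcard : Nat.card {p : leading r V // (p : P) ≠ p₀} =
          Nat.card (leading r V) - 1 := by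
        have := Fintype.card_subtype_compl (fun p : leading r V => (p : P) = p₀)
        rw [Nat.card_eq_fintype_card, Nat.card_eq_fintype_card, this]
        congr 1
        exact Fintype.card_eq_one_iff.2 ⟨⟨⟨p₀, h⟩, rfl⟩, fun y => by
          ext
          exact y.2⟩
      rw [affineClass_mvPolynomial, hcard, sliceClass]
      simp [kerOn_empty, h]
    -- As `p₀` comes first, not being leading means that this coordinate vanishes on `V`. Then `w p₀
    -- = 1` holds only over the zero ring, and `k ⧸ ⊤` represents the empty slice.
    · have hV : V ≤ kerAt V p₀ := fun v hv => mem_kerAt.2 ⟨hv, by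
        by_contra hne
        exact h ⟨v, hv, hne, fun q hq => absurd (hp₀ q) (not_le.2 hq)⟩⟩
      have hV' : kerAt V p₀ = V := le_antisymm inf_le_left hV
      refine ⟨k ⧸ (⊤ : Ideal k), _, _, 0, ⟨fun {R} _ _ φ => ?_, fun {R} _ _ w hw => ?_,
        fun {R} _ _ φ ψ _ => ?_⟩, inferInstance, ?_⟩
      · have : Subsingleton R := φ.toRingHom.codomain_trivial
        exact ⟨by convert Submodule.zero_mem _, Subsingleton.elim _ _, by simp⟩
      · have h0 : w p₀ = 0 := (mem_baseSpan_kerAt.1 (hV'.symm ▸ hw.1)).2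
        have : Subsingleton R := subsingleton_of_zero_eq_one (h0.symm.trans hw.2.1)
        exact ⟨Ideal.Quotient.liftₐ _ (Algebra.ofId k R) fun _ _ => Subsingleton.elim _ _,
          fun _ => Subsingleton.elim _ _⟩
      · exact Ideal.Quotient.algHom_ext _ (Subsingleton.elim _ _)
      · rw [affineClass_of_subsingleton, sliceClass]
        simp [kerOn_empty, h]
  | insert p T hp ih =>
    obtain ⟨A, _, _, u, hu, hft, hA⟩ := ih V
    obtain ⟨B, _, _, w, hw, hft', hB⟩ := ih (kerAt V p)
    have hloc := hu.localization p
    have hquot := (hu.quotient p).congr (G := slicePoints (kerAt V p) p₀ T) fun R _ _ x => by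
      simp only [slicePoints, Set.mem_ofPred_eq, mem_baseSpan_kerAt]
      tauto
    obtain ⟨e⟩ := hw.nonempty_algEquiv hquot
    have : Algebra.FiniteType A (Localization.Away (u p)) :=
      IsLocalization.finiteType_of_monoid_fg (.powers (u p)) _
    refine ⟨_, _, _, _, hloc.congr fun R _ _ x => ?_, .trans hft this, ?_⟩
    · simp only [slicePoints, Set.mem_ofPred_eq, Finset.forall_mem_insert]
      tauto
    · rw [eq_sub_of_add_eq (affineClass_scissors A (u p)).symm, hA, ← affineClass_congr e, hB,
        sliceClass, sliceClass, sliceClass, Finset.sum_powerset_insert hp, sub_eq_add_neg,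
        ← Finset.sum_neg_distrib]
      congr 1
      refine Finset.sum_congr rfl fun J hJ => ?_
      rw [Finset.card_insert_of_notMem fun h => hp (Finset.mem_powerset.1 hJ h), kerOn_insert,
        pow_succ]
      ring

end Representability

/-! ### Tuples of power series truncated below the conductor. -/

section Truncation

variable {k : Type u} [Field k] {d : ℕ} (O : Subalgebra k (Fin d → k⟦X⟧))
  {R : Type u} [CommRing R]

/-- The coefficients, at the positions below the conductor, of a tuple of power series. -/
def truncate (x : Fin d → R⟦X⟧) (p : Pos O) : R := PowerSeries.coeff (p.2 : ℕ) (x p.1)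

variable (R) in
lemma truncate_surjective : Function.Surjective (truncate O (R := R)) := fun a =>
  ⟨fun i => PowerSeries.mk fun j => if h : j < conductor O i then a ⟨i, j, h⟩ else 0, by
    ext p
    simp [truncate]⟩

lemma mulCoeff_truncate (x y : Fin d → R⟦X⟧) :
    mulCoeff (truncate O x) (truncate O y) = truncate O (x * y) := by
  ext p
  simp only [mulCoeff, truncate, Pi.mul_apply, PowerSeries.coeff_mul]
  rw [Finset.Nat.sum_antidiagonal_eq_sum_range_succ
    (fun i j => PowerSeries.coeff i (x p.1) * PowerSeries.coeff j (y p.1)), Finset.sum_range]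

variable {O}

lemma mulCoeff_comm (a b : Pos O → R) : mulCoeff a b = mulCoeff b a := by
  obtain ⟨x, rfl⟩ := truncate_surjective O R a
  obtain ⟨y, rfl⟩ := truncate_surjective O R b
  rw [mulCoeff_truncate, mulCoeff_truncate, mul_comm]

lemma mulCoeff_assoc (a b c : Pos O → R) :
    mulCoeff (mulCoeff a b) c = mulCoeff a (mulCoeff b c) := by
  obtain ⟨x, rfl⟩ := truncate_surjective O R a
  obtain ⟨y, rfl⟩ := truncate_surjective O R b
  obtain ⟨z, rfl⟩ := truncate_surjective O R c
  simp only [mulCoeff_truncate, mul_assoc]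

lemma mulCoeff_one (a : Pos O → R) : mulCoeff a (truncate O 1) = a := by
  obtain ⟨x, rfl⟩ := truncate_surjective O R a
  rw [mulCoeff_truncate, mul_one]

/-- Multiplication of truncated tuples of power series by a fixed one. -/
def mulLeft (a : Pos O → R) : (Pos O → R) →ₗ[R] (Pos O → R) where
  toFun := mulCoeff a
  map_add' b c := by
    ext p
    simp [mulCoeff, mul_add, Finset.sum_add_distrib]
  map_smul' s b := by
    ext p
    simp [mulCoeff, Finset.mul_sum, mul_left_comm]

lemma mulLeft_apply (a b : Pos O → R) : mulLeft a b = mulCoeff a b := rfl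

lemma map_mulCoeff {S : Type u} [CommRing S] (φ : R →+* S) (a b : Pos O → R) (p : Pos O) :
    φ (mulCoeff a b p) = mulCoeff (fun q => φ (a q)) (fun q => φ (b q)) p := by
  simp [mulCoeff]

/-- The position of the constant coefficient of the component of `p`. -/
def Pos.zero (p : Pos O) : Pos O := ⟨p.1, 0, (Nat.zero_le _).trans_lt p.2.2⟩

/-- The rank of a position: smaller exponents first. -/
def Pos.rank (p : Pos O) : ℕ := p.2 * d + p.1

lemma Pos.rank_injective : Function.Injective (Pos.rank (O := O)) := by
  rintro ⟨i, j, hj⟩ ⟨i', j', hj'⟩ h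
  simp only [Pos.rank] at h
  have hd : 0 < d := i.pos
  have h2 : (j * d + i) % d = (j' * d + i') % d := by rw [h]
  rw [Nat.mul_add_mod_self_right, Nat.mul_add_mod_self_right, Nat.mod_eq_of_lt i.2,
    Nat.mod_eq_of_lt i'.2] at h2
  obtain rfl : i = i' := Fin.ext h2
  obtain rfl : j = j' := Nat.eq_of_mul_eq_mul_right hd (by simpa using h)
  rfl

lemma Pos.rank_lt {p q : Pos O} (hi : q.1 = p.1) (h : (q.2 : ℕ) < p.2) : q.rank < p.rank := by
  have hd : 0 < d := p.1.pos
  simp only [Pos.rank, hi]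
  gcongr

/-- The coefficient at `p` only involves `z` at positions of the same component with exponent at
most that of `p`, none of them of higher rank. This is the source of triangularity. -/
lemma mulCoeff_eq_of_forall_lt (a z : Pos O → R) (p : Pos O)
    (h : ∀ q : Pos O, q.rank < p.rank → z q = 0) : mulCoeff a z p = a p.zero * z p := by
  rw [mulCoeff, Finset.sum_eq_single 0]
  · congr 1
  · intro q _ hq
    rw [h, mul_zero]
    have h0 : (q : ℕ) ≠ 0 := fun h => hq (Fin.ext h)
    exact Pos.rank_lt rfl (by dsimp only; have := q.2; omega)
  · simp

lemma mulCoeff_eq_zero_of_forall_lt (a z : Pos O → R) (p q : Pos O)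
    (h : ∀ q : Pos O, q.rank < p.rank → z q = 0) (hq : q.rank < p.rank) : mulCoeff a z q = 0 := by
  rw [mulCoeff_eq_of_forall_lt a z q fun s hs => h s (hs.trans hq), h q hq, mul_zero]

variable (O) in
/-- The subspace `𝒪 / ℱ` of `𝒪~ / ℱ`. -/
def truncSpace : Submodule k (Pos O → k) where
  carrier := {w | ∃ z ∈ O, w = truncate O z}
  zero_mem' := ⟨0, O.zero_mem, by ext; simp [truncate]⟩
  add_mem' := by
    rintro _ _ ⟨x, hx, rfl⟩ ⟨y, hy, rfl⟩
    exact ⟨x + y, O.add_mem hx hy, by ext; simp [truncate]⟩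
  smul_mem' := by
    rintro a _ ⟨x, hx, rfl⟩
    exact ⟨a • x, O.smul_mem hx a, by ext; simp [truncate]⟩

lemma truncate_mem_truncSpace {z : Fin d → k⟦X⟧} (hz : z ∈ O) : truncate O z ∈ truncSpace O :=
  ⟨z, hz, rfl⟩

/-- Multiplication by `t^n` on truncated tuples of power series. -/
def shift (n : Fin d → ℕ) : (Pos O → R) →ₗ[R] (Pos O → R) where
  toFun w p := if n p.1 ≤ (p.2 : ℕ) then
    w ⟨p.1, (p.2 : ℕ) - n p.1, (Nat.sub_le _ _).trans_lt p.2.2⟩ else 0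
  map_add' v w := by
    ext p
    by_cases h : n p.1 ≤ (p.2 : ℕ) <;> simp [h]
  map_smul' a w := by
    ext p
    by_cases h : n p.1 ≤ (p.2 : ℕ) <;> simp [h]

lemma shift_apply (n : Fin d → ℕ) (w : Pos O → R) (p : Pos O) :
    shift n w p = if n p.1 ≤ (p.2 : ℕ) then
      w ⟨p.1, (p.2 : ℕ) - n p.1, (Nat.sub_le _ _).trans_lt p.2.2⟩ else 0 := rfl

lemma shift_truncate (n : Fin d → ℕ) (x : Fin d → R⟦X⟧) :
    shift n (truncate O x) = truncate O fun i => PowerSeries.X ^ n i * x i := by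
  ext p
  simp [shift_apply, truncate, PowerSeries.coeff_X_pow_mul']

lemma shift_mulCoeff (n : Fin d → ℕ) (a b : Pos O → R) :
    shift n (mulCoeff a b) = mulCoeff (shift n a) b := by
  obtain ⟨x, rfl⟩ := truncate_surjective O R a
  obtain ⟨y, rfl⟩ := truncate_surjective O R b
  rw [mulCoeff_truncate, shift_truncate, shift_truncate, mulCoeff_truncate]
  congr 1
  ext1 i
  simp [mul_assoc]

lemma map_shift {S : Type u} [CommRing S] (φ : R →+* S) (n : Fin d → ℕ) (w : Pos O → R)
    (p : Pos O) : φ (shift n w p) = shift n (fun q => φ (w q)) p := by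
  simp [shift_apply, apply_ite φ]

variable [Algebra k R]

lemma ringPoints_eq : ringPoints O R = baseSpan R (truncSpace O) := by
  refine congrArg (Submodule.span R) (Set.ext fun w => ⟨?_, ?_⟩)
  · rintro ⟨z, hz, rfl⟩
    exact ⟨_, ⟨z, hz, rfl⟩, rfl⟩
  · rintro ⟨_, ⟨z, hz, rfl⟩, rfl⟩
    exact ⟨z, hz, rfl⟩

variable (O R) in
lemma one_mem_baseSpan : truncate O (1 : Fin d → R⟦X⟧) ∈ baseSpan R (truncSpace O) := by
  convert mem_baseSpan (R := R) (truncate_mem_truncSpace O.one_mem) using 1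
  ext p
  simp [truncate, PowerSeries.coeff_one, apply_ite (algebraMap k R)]

lemma mulCoeff_mem_baseSpan {a b : Pos O → R} (ha : a ∈ baseSpan R (truncSpace O))
    (hb : b ∈ baseSpan R (truncSpace O)) : mulCoeff a b ∈ baseSpan R (truncSpace O) := by
  suffices H : baseSpan R (truncSpace O) ≤ (baseSpan R (truncSpace O)).comap (mulLeft a) from H hb
  refine Submodule.span_le.2 ?_
  rintro _ ⟨_, ⟨y, hy, rfl⟩, rfl⟩
  change mulLeft a _ ∈ baseSpan R (truncSpace O)
  rw [mulLeft_apply, mulCoeff_comm]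
  suffices H : baseSpan R (truncSpace O) ≤ (baseSpan R (truncSpace O)).comap
    (mulLeft fun p => algebraMap k R (truncate O y p)) from H ha
  refine Submodule.span_le.2 ?_
  rintro _ ⟨_, ⟨x, hx, rfl⟩, rfl⟩
  change mulLeft _ _ ∈ baseSpan R (truncSpace O)
  rw [mulLeft_apply]
  convert mem_baseSpan (R := R) (truncate_mem_truncSpace (O.mul_mem hy hx)) using 1
  ext p
  rw [← mulCoeff_truncate, map_mulCoeff]

variable (O) in
/-- The subspace `{w | t^n w ∈ 𝒪}` of `𝒪~ / ℱ`. -/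
def shiftSpace (n : Fin d → ℕ) : Submodule k (Pos O → k) := (truncSpace O).comap (shift n)

/-- Preimage under the `k`-linear map `shift n` commutes with base change, because every equation of
the preimage is pulled back from one of `𝒪/ℱ`. -/
lemma mem_baseSpan_shiftSpace {n : Fin d → ℕ} {w : Pos O → R} :
    w ∈ baseSpan R (shiftSpace O n) ↔ shift n w ∈ baseSpan R (truncSpace O) := by
  classical
  constructor
  · intro h
    suffices H : baseSpan R (shiftSpace O n) ≤ (baseSpan R (truncSpace O)).comap (shift n) from H h
    refine Submodule.span_le.2 ?_
    rintro _ ⟨v, hv, rfl⟩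
    have : shift n (fun p => algebraMap k R (v p)) = fun p => algebraMap k R (shift n v p) :=
      funext fun p => (map_shift (algebraMap k R) n v p).symm
    change shift n (fun p => algebraMap k R (v p)) ∈ baseSpan R (truncSpace O)
    rw [this]
    exact mem_baseSpan (V := truncSpace O) hv
  · intro h
    rw [mem_baseSpan_iff_forall] at h ⊢
    intro l hl
    let f : (Pos O → k) →ₗ[k] k := Fintype.linearCombination k l
    have hf : ∀ v, f v = ∑ p, l p * v p := fun v => by
      simp [f, Fintype.linearCombination_apply, mul_comm]
    -- As `f` kills the kernel of `mkQ ∘ shift n`, it factors through this map; the factor `m`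
    -- yields the equation `l'` of `𝒪/ℱ` that pulls back to `l`.
    have hmem : f ∈ (LinearMap.ker ((truncSpace O).mkQ ∘ₗ shift n)).dualAnnihilator := by
      rw [Submodule.mem_dualAnnihilator]
      intro v hv
      rw [hf]
      refine hl v ?_
      rwa [LinearMap.ker_comp, Submodule.ker_mkQ] at hv
    rw [← LinearMap.range_dualMap_eq_dualAnnihilator_ker] at hmem
    obtain ⟨m, hm⟩ := hmem
    have hm' : ∀ v, m ((truncSpace O).mkQ (shift n v)) = f v := fun v => LinearMap.congr_fun hm v
    let l' : Pos O → k := fun p => m ((truncSpace O).mkQ (Pi.single p 1))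
    have hl' : ∀ v : Pos O → k, ∑ p, l' p * v p = m ((truncSpace O).mkQ v) := fun v => by
      conv_rhs => rw [pi_eq_sum_univ' v]
      simp only [map_sum, map_smul, smul_eq_mul, l', mul_comm]
    -- Both sides are `R`-linear in `w`, so the standard basis vectors suffice, and these come from
    -- `k`.
    have key : ∑ p, l' p • shift n w p = ∑ p, l p • w p := by
      let f₁ : (Pos O → R) →ₗ[R] R := ∑ p, algebraMap k R (l' p) • (LinearMap.proj p ∘ₗ shift n)
      let f₂ : (Pos O → R) →ₗ[R] R := ∑ p, algebraMap k R (l p) • LinearMap.proj p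
      have : f₁ = f₂ := by
        refine LinearMap.pi_ext' fun q => LinearMap.ext_ring ?_
        have h1 : ∑ p, l' p * shift n (Pi.single q (1 : k)) p = l q := by
          rw [hl', hm', hf]
          simp [Pi.single_apply]
        have h2 : (Pi.single q (1 : R) : Pos O → R) =
            fun p => algebraMap k R ((Pi.single q (1 : k) : Pos O → k) p) := by
          ext p
          simp [Pi.single_apply, apply_ite (algebraMap k R)]
        simp only [f₁, f₂, LinearMap.comp_apply, LinearMap.coe_single, LinearMap.sum_apply,
          LinearMap.smul_apply, LinearMap.proj_apply, smul_eq_mul]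
        rw [h2]
        simp_rw [← map_shift, ← map_mul, ← map_sum, h1]
        simp [Pi.single_apply]
      simpa [f₁, f₂, Algebra.smul_def] using LinearMap.congr_fun this w
    rw [← key]
    refine h l' fun v hv => ?_
    rw [hl', Submodule.mkQ_apply, (Submodule.Quotient.mk_eq_zero _).2 hv, map_zero]

end Truncation

/-! ### Points of the unit group and normal forms modulo `𝒪ˣ`. -/

section Points

variable {k : Type u} [Field k] {d : ℕ} {O : Subalgebra k (Fin d → k⟦X⟧)}
  {R : Type u} [CommRing R]

/-- The constant coefficients of a truncated tuple of power series are units. -/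
def HasUnitConst (a : Pos O → R) : Prop := ∀ p : Pos O, (p.2 : ℕ) = 0 → IsUnit (a p)

lemma mulCoeff_apply_of_exp_eq_zero (a b : Pos O → R) {p : Pos O} (hp : (p.2 : ℕ) = 0) :
    mulCoeff a b p = a p * b p := by
  obtain ⟨i, j, hj⟩ := p
  obtain rfl : j = 0 := hp
  rw [mulCoeff, Fin.sum_univ_one]
  rfl

lemma HasUnitConst.mulCoeff {a b : Pos O → R} (ha : HasUnitConst a) (hb : HasUnitConst b) :
    HasUnitConst (mulCoeff a b) := fun p hp => by
  rw [mulCoeff_apply_of_exp_eq_zero a b hp]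
  exact (ha p hp).mul (hb p hp)

variable [Algebra k R]

lemma UnitCoord.hom_ext {φ ψ : UnitCoord O →ₐ[k] R} (h : ∀ p, φ (coord O p) = ψ (coord O p)) :
    φ = ψ :=
  IsLocalization.algHom_ext
    (Submonoid.powers
      (∏ p : Pos O with (p.2 : ℕ) = 0, (MvPolynomial.X p : MvPolynomial (Pos O) k)))
    (MvPolynomial.algHom_ext (f := φ.comp (IsScalarTower.toAlgHom k _ _))
      (g := ψ.comp (IsScalarTower.toAlgHom k _ _)) h)

/-- The point of `𝒪~ˣ / (1 + ℱ)` with given coordinates. -/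
def pointOf (a : Pos O → R) (ha : HasUnitConst a) : UnitCoord O →ₐ[k] R :=
  IsLocalization.liftAlgHom
    (M := Submonoid.powers
      (∏ p : Pos O with (p.2 : ℕ) = 0, (MvPolynomial.X p : MvPolynomial (Pos O) k)))
    (f := MvPolynomial.aeval a) (by
      rintro ⟨_, n, rfl⟩
      rw [map_pow, map_prod]
      refine IsUnit.pow n ((IsUnit.prod_iff (M := R)).2 fun p hp => ?_)
      rw [MvPolynomial.aeval_X]
      exact ha p (Finset.mem_filter.1 hp).2)

@[simp]
lemma pointOf_coord (a : Pos O → R) (ha : HasUnitConst a) (p : Pos O) :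
    pointOf a ha (coord O p) = a p := by
  simp [pointOf, coord]

@[simp]
lemma mulPoint_coord (g h : UnitCoord O →ₐ[k] R) (p : Pos O) :
    mulPoint g h (coord O p) =
      mulCoeff (fun q => g (coord O q)) (fun q => h (coord O q)) p := by
  rw [mulPoint, coord, IsLocalization.liftAlgHom_apply, IsLocalization.lift_eq]
  exact MvPolynomial.aeval_X _ _

lemma hasUnitConst_point (g : UnitCoord O →ₐ[k] R) : HasUnitConst fun p => g (coord O p) :=
  fun p hp => (coord_isUnit O p hp).map g

lemma forall_shiftIdeal_eq_zero_iff {n : Fin d → ℕ} (g : UnitCoord O →ₐ[k] R) :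
    (∀ f ∈ shiftIdeal O n, g f = 0) ↔
      (fun p => g (coord O p)) ∈ baseSpan R (shiftSpace O n) := by
  have key : ∀ p, g (shiftCoord O n p) = shift n (fun q => g (coord O q)) p := fun p => by
    simp [shiftCoord, shift_apply, apply_ite g]
  rw [mem_baseSpan_shiftSpace, mem_baseSpan_iff_forall]
  constructor
  · intro h l hl
    rw [← h _ (Ideal.subset_span ⟨l, fun z hz => hl _ (truncate_mem_truncSpace hz), rfl⟩)]
    simp [key]
  · intro h
    suffices H : shiftIdeal O n ≤ RingHom.ker g from fun f hf => H hf
    refine Ideal.span_le.2 ?_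
    rintro _ ⟨l, hl, rfl⟩
    have := h l (by
      rintro _ ⟨z, hz, rfl⟩
      exact hl z hz)
    simpa [key] using this

variable (O) in
/-- All components of an element of `𝒪` have the same constant coefficient. -/
def HasEqualConst : Prop :=
  ∀ z ∈ O, ∀ i j, PowerSeries.constantCoeff (z i) = PowerSeries.constantCoeff (z j)

lemma HasEqualConst.apply_eq (hO : HasEqualConst O) {h : Pos O → R}
    (hh : h ∈ baseSpan R (truncSpace O)) {p q : Pos O} (hp : (p.2 : ℕ) = 0) (hq : (q.2 : ℕ) = 0) :
    h p = h q := by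
  induction hh using Submodule.span_induction with
  | mem w hw =>
    obtain ⟨_, ⟨z, hz, rfl⟩, rfl⟩ := hw
    simp only [truncate, hp, hq, PowerSeries.coeff_zero_eq_constantCoeff]
    rw [hO z hz]
  | zero => rfl
  | add x y _ _ hx hy => simp [hx, hy]
  | smul a x _ hx => simp [hx]

/-- Linear equations `(a z)_p = y_p`, for `p` a leading position, have exactly one solution `z`
in the span of `𝒪 / ℱ`. -/
lemma existsUnique_mulCoeff_eq (a : Pos O → R) (ha : HasUnitConst a)
    (y : leading Pos.rank (truncSpace O) → R) :
    ∃! z, z ∈ baseSpan R (truncSpace O) ∧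
      ∀ p : leading Pos.rank (truncSpace O), mulCoeff a z p = y p := by
  obtain ⟨b, hb⟩ := exists_isReducedBasis Pos.rank_injective (truncSpace O)
  have hlt : ∀ (p : leading Pos.rank (truncSpace O)) (q : Pos O), q.rank < (p : Pos O).rank →
      algebraMap k R (b p q) = 0 := fun p q h => by rw [hb.lt p q h, map_zero]
  let M : Matrix (leading Pos.rank (truncSpace O)) (leading Pos.rank (truncSpace O)) R :=
    Matrix.of fun q p => mulCoeff a (fun s => algebraMap k R (b p s)) q
  -- The columns are the products `a b_p`. Such a product starts at `p`, where its coefficient is a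
  -- constant coefficient of `a`, hence a unit.
  have hM : Function.Bijective (M.mulVec ·) := by
    refine bijective_mulVec_of_triangular (r := fun p : leading Pos.rank (truncSpace O) => (p : Pos O).rank)
      (Pos.rank_injective.comp Subtype.val_injective) M (fun p q h => ?_) fun p => ?_
    · exact mulCoeff_eq_zero_of_forall_lt a _ (p : Pos O) (q : Pos O) (hlt p) h
    · change IsUnit (mulCoeff a (fun s => algebraMap k R (b p s)) (p : Pos O))
      rw [mulCoeff_eq_of_forall_lt _ _ _ (hlt p), hb.self, map_one, mul_one]
      exact ha _ rfl
  have hMx : ∀ (x : leading Pos.rank (truncSpace O) → R) q,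
      M.mulVec x q = mulCoeff a (fun s => ∑ p, x p * algebraMap k R (b p s)) q := fun x q => by
    have : (fun s => ∑ p, x p * algebraMap k R (b p s)) =
        ∑ p, x p • fun s => algebraMap k R (b p s) := by
      ext s
      simp
    rw [this, ← mulLeft_apply, map_sum]
    simp [Matrix.mulVec, dotProduct, M, mulLeft_apply, mul_comm]
  obtain ⟨x, hx⟩ := hM.2 y
  refine ⟨_, ⟨hb.sum_mem_baseSpan x, fun p => by rw [← hMx, ← hx]⟩, fun z hz => ?_⟩
  have hz' := funext (hb.mem_baseSpan_iff.1 hz.1)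
  have : x = fun p : leading _ _ => z p := hM.1 (hx.trans (funext fun p => by
    change _ = M.mulVec _ p
    rw [hMx, ← hz', hz.2]))
  rw [hz', this]

/-- The coordinates at the leading positions of `𝒪 / ℱ` are those of `1`. -/
def IsNormal (p₀ : Pos O) (w : Pos O → R) : Prop :=
  ∀ p : leading Pos.rank (truncSpace O), w p = if (p : Pos O) = p₀ then 1 else 0

variable {p₀ : Pos O}

lemma exp_eq_zero_of_isMin (hp₀ : ∀ q : Pos O, p₀.rank ≤ q.rank) : (p₀.2 : ℕ) = 0 := by
  by_contra h
  exact absurd (hp₀ p₀.zero) (not_le.2 (Pos.rank_lt rfl (Nat.pos_of_ne_zero h)))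

lemma mem_leading_truncSpace (hp₀ : ∀ q : Pos O, p₀.rank ≤ q.rank) :
    p₀ ∈ leading Pos.rank (truncSpace O) :=
  ⟨_, truncate_mem_truncSpace O.one_mem, by
    simp [truncate, exp_eq_zero_of_isMin hp₀], fun q hq => absurd (hp₀ q) (not_le.2 hq)⟩

/-- An element of `𝒪` that vanishes at `p₀` has all constant coefficients zero, so `p₀` is the only
leading position of exponent zero. -/
lemma HasEqualConst.isNormal_one (R : Type u) [CommRing R] (hO : HasEqualConst O) (hp₀ : ∀ q : Pos O, p₀.rank ≤ q.rank) :
    IsNormal p₀ (truncate O (1 : Fin d → R⟦X⟧)) := by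
  intro p
  have h0 := exp_eq_zero_of_isMin hp₀
  split_ifs with h
  · obtain ⟨p, hp⟩ := p
    obtain rfl : p = p₀ := h
    simp [truncate, h0]
  · rw [truncate, Pi.one_apply, PowerSeries.coeff_one, if_neg]
    intro hp
    obtain ⟨v, ⟨z, hz, rfl⟩, hv, hv'⟩ := p.2
    refine hv ?_
    have hlt : p₀.rank < Pos.rank (p : Pos O) :=
      lt_of_le_of_ne (hp₀ p) fun h' => h (Pos.rank_injective h'.symm)
    rw [← hv' p₀ hlt]
    simp only [truncate, hp, h0, PowerSeries.coeff_zero_eq_constantCoeff]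
    exact hO z hz _ _

lemma IsNormal.apply_self {R : Type u} [CommRing R] {w : Pos O → R} (hw : IsNormal p₀ w)
    (hp₀ : ∀ q : Pos O, p₀.rank ≤ q.rank) : w p₀ = 1 :=
  (hw ⟨p₀, mem_leading_truncSpace hp₀⟩).trans (if_pos rfl)

lemma eq_of_isNormal_mulCoeff {a z z' : Pos O → R} (ha : HasUnitConst a)
    (hz : z ∈ baseSpan R (truncSpace O)) (hz' : z' ∈ baseSpan R (truncSpace O))
    (h : IsNormal p₀ (mulCoeff a z)) (h' : IsNormal p₀ (mulCoeff a z')) : z = z' :=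
  (existsUnique_mulCoeff_eq a ha _).unique ⟨hz, h⟩ ⟨hz', h'⟩

/-- The `z` that brings `h` into normal form is the inverse: `h z` and `1` both lie in the span of
`𝒪/ℱ` and agree at its leading positions. -/
lemma HasEqualConst.exists_inverse (hO : HasEqualConst O) (hp₀ : ∀ q : Pos O, p₀.rank ≤ q.rank)
    {h : Pos O → R} (hh : h ∈ baseSpan R (truncSpace O)) (hu : HasUnitConst h) :
    ∃ z ∈ baseSpan R (truncSpace O), mulCoeff h z = truncate O 1 := by
  obtain ⟨z, ⟨hz, hz'⟩, -⟩ := existsUnique_mulCoeff_eq h hu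
    (fun p => if (p : Pos O) = p₀ then 1 else 0)
  obtain ⟨b, hb⟩ := exists_isReducedBasis Pos.rank_injective (truncSpace O)
  refine ⟨z, hz, hb.ext (mulCoeff_mem_baseSpan hh hz) (one_mem_baseSpan O R) fun p => ?_⟩
  rw [hz', hO.isNormal_one R hp₀]

lemma HasEqualConst.hasUnitConst (hO : HasEqualConst O) (hp₀ : (p₀.2 : ℕ) = 0)
    {h : Pos O → R} (hh : h ∈ baseSpan R (truncSpace O)) (hu : IsUnit (h p₀)) :
    HasUnitConst h := fun _ hp => hO.apply_eq hh hp₀ hp ▸ hu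

lemma HasEqualConst.hasUnitConst_of_eq_one (hO : HasEqualConst O) (hp₀ : (p₀.2 : ℕ) = 0)
    {h : Pos O → R} (hh : h ∈ baseSpan R (truncSpace O)) (h1 : h p₀ = 1) : HasUnitConst h :=
  hO.hasUnitConst hp₀ hh (h1 ▸ isUnit_one)

lemma mulCoeff_mem_shiftSpace {n : Fin d → ℕ} {a h : Pos O → R}
    (ha : a ∈ baseSpan R (shiftSpace O n)) (hh : h ∈ baseSpan R (truncSpace O)) :
    mulCoeff a h ∈ baseSpan R (shiftSpace O n) := by
  rw [mem_baseSpan_shiftSpace] at ha ⊢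
  rw [shift_mulCoeff]
  exact mulCoeff_mem_baseSpan ha hh

variable (O) in
/-- A point `η` of `𝒪ˣ / (1 + ℱ)` with values in the coordinate ring of `𝒪~ˣ / (1 + ℱ)` which
multiplies the universal point into normal form. -/
structure IsNormalizer (p₀ : Pos O) (η : Pos O → UnitCoord O) : Prop where
  mem : η ∈ baseSpan (UnitCoord O) (truncSpace O)
  isNormal : IsNormal p₀ (mulCoeff (coord O) η)

lemma exists_isNormalizer : ∃ η, IsNormalizer O p₀ η := by
  obtain ⟨η, ⟨h, h'⟩, -⟩ := existsUnique_mulCoeff_eq (coord O) (coord_isUnit O)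
    (fun p => if (p : Pos O) = p₀ then 1 else 0)
  exact ⟨η, h, h'⟩

/-- The normal form has coordinate `1` at `p₀`, so `η p₀` is invertible; the other constant
coefficients of `η` equal it. -/
lemma IsNormalizer.hasUnitConst {η : Pos O → UnitCoord O} (hη : IsNormalizer O p₀ η)
    (hO : HasEqualConst O) (hp₀ : ∀ q : Pos O, p₀.rank ≤ q.rank) : HasUnitConst η := by
  have h0 := exp_eq_zero_of_isMin hp₀
  refine hO.hasUnitConst h0 hη.mem ?_
  have := hη.isNormal.apply_self hp₀
  rw [mulCoeff_apply_of_exp_eq_zero _ _ h0] at this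
  exact .of_mul_eq_one_right _ this

end Points

/-! ### The coordinate ring of `ℐ_n` as functions on normal forms. -/

section Jacobian

open TensorProduct

variable {k : Type u} [Field k] {d : ℕ} {O : Subalgebra k (Fin d → k⟦X⟧)}
  {R : Type u} [CommRing R] [Algebra k R] {p₀ : Pos O} {η : Pos O → UnitCoord O}

lemma IsNormal.map {S : Type u} [CommRing S] [Algebra k S] (φ : R →ₐ[k] S) {w : Pos O → R}
    (hw : IsNormal p₀ w) : IsNormal p₀ fun p => φ (w p) := fun p => by
  simp [hw p, apply_ite φ]

/-- The normal form of the universal point, as an endomorphism of the coordinate ring. -/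
def normalHom (η : Pos O → UnitCoord O) (h : HasUnitConst η) : UnitCoord O →ₐ[k] UnitCoord O :=
  pointOf (mulCoeff (coord O) η) (HasUnitConst.mulCoeff (coord_isUnit O) h)

lemma comp_normalHom_coord (h : HasUnitConst η) (g : UnitCoord O →ₐ[k] R) :
    (fun p => g (normalHom η h (coord O p))) =
      mulCoeff (fun p => g (coord O p)) fun p => g (η p) := by
  ext p
  rw [normalHom, pointOf_coord]
  exact map_mulCoeff g.toRingHom _ _ p

lemma IsNormalizer.isNormal_comp (hη : IsNormalizer O p₀ η) (g : UnitCoord O →ₐ[k] R) :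
    IsNormal p₀ (mulCoeff (fun p => g (coord O p)) fun p => g (η p)) := by
  have := hη.isNormal.map g
  exact (funext fun p => map_mulCoeff g.toRingHom (coord O) η p) ▸ this

/-- Both `1` and `η(g)` bring a normal `g` into normal form, so `η(g) = 1` by uniqueness. -/
lemma IsNormalizer.comp_normalHom_of_isNormal (hη : IsNormalizer O p₀ η) (h : HasUnitConst η) (g : UnitCoord O →ₐ[k] R)
    (hg : IsNormal p₀ fun p => g (coord O p)) : g.comp (normalHom η h) = g := by
  refine UnitCoord.hom_ext fun p => ?_
  have h1 : (fun p => g (η p)) = truncate O 1 :=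
    eq_of_isNormal_mulCoeff (hasUnitConst_point g) (baseSpan_map g hη.mem) (one_mem_baseSpan O R)
      (hη.isNormal_comp g) (by rwa [mulCoeff_one])
  have h2 := comp_normalHom_coord h g
  rw [h1, mulCoeff_one] at h2
  exact congrFun h2 p

lemma IsNormalizer.normalHom_normalHom (hη : IsNormalizer O p₀ η) (h : HasUnitConst η) (f : UnitCoord O) :
    normalHom η h (normalHom η h f) = normalHom η h f := by
  refine DFunLike.congr_fun (hη.comp_normalHom_of_isNormal h (normalHom η h) ?_) f
  simpa [normalHom] using hη.isNormal

/-- Invariance applied to the universal point and `η` gives `normalHom η h f = f`. Conversely, `g`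
and `g h'` have the same normal form, since `h' η(g h')` and `η(g)` both normalize `g`. -/
lemma IsNormalizer.mem_jacCoord_iff (hη : IsNormalizer O p₀ η) (h : HasUnitConst η)
    (f : UnitCoord O) : f ∈ jacCoord O ↔ normalHom η h f = f := by
  constructor
  · intro hf
    have := hf (UnitCoord O) (AlgHom.id k _) (pointOf η h) (by
      rw [ringPoints_eq]
      simpa using hη.mem)
    have h' : mulPoint (AlgHom.id k _) (pointOf η h) = normalHom η h :=
      UnitCoord.hom_ext fun p => by simp [normalHom]
    rwa [h'] at this
  · intro hf R _ _ g h' hh'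
    rw [ringPoints_eq] at hh'
    rw [← hf]
    change ((mulPoint g h').comp (normalHom η h)) f = (g.comp (normalHom η h)) f
    congr 1
    refine UnitCoord.hom_ext fun p => ?_
    have h1 := comp_normalHom_coord h (mulPoint g h')
    have h2 := hη.isNormal_comp (mulPoint g h')
    have h3 : (fun p => mulPoint g h' (coord O p)) =
      mulCoeff (fun q => g (coord O q)) (fun q => h' (coord O q)) :=
      funext fun p => mulPoint_coord g h' p
    rw [h3, mulCoeff_assoc] at h1 h2
    have h4 := eq_of_isNormal_mulCoeff (hasUnitConst_point g)
      (mulCoeff_mem_baseSpan hh' (baseSpan_map (mulPoint g h') hη.mem))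
      (baseSpan_map g hη.mem) h2 (hη.isNormal_comp g)
    rw [h4, ← comp_normalHom_coord h] at h1
    exact congrFun h1 p

variable (O) in
/-- The coordinate ring of `ℐ_n`. -/
abbrev IdealsCoord (n : Fin d → ℕ) : Type u :=
  jacCoord O ⧸ (shiftIdeal O n).comap (jacCoord O).val

/-- The tuples in normal form, with invertible constant coefficients, which `t^n` multiplies
into `𝒪`. -/
def normalPoints (p₀ : Pos O) (n : Fin d → ℕ) (R : Type u) [CommRing R] [Algebra k R] :
    Set (Pos O → R) :=
  {w | IsNormal p₀ w ∧ HasUnitConst w ∧ w ∈ baseSpan R (shiftSpace O n)}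

/-- The morphism from `𝒪~ˣ / (1 + ℱ)` to `𝒥`, restricted to `ℐ_n`. -/
def IsNormalizer.toIdealsCoord (hη : IsNormalizer O p₀ η) (h : HasUnitConst η)
    (n : Fin d → ℕ) :
    UnitCoord O →ₐ[k] IdealsCoord O n :=
  (Ideal.Quotient.mkₐ k _).comp ((normalHom η h).codRestrict (jacCoord O) fun f =>
    (hη.mem_jacCoord_iff h _).2 (hη.normalHom_normalHom h f))

lemma IsNormalizer.toIdealsCoord_surjective (hη : IsNormalizer O p₀ η) (h : HasUnitConst η)
    (n : Fin d → ℕ) :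
    Function.Surjective (hη.toIdealsCoord h n) := by
  intro x
  obtain ⟨⟨f, hf⟩, rfl⟩ := Ideal.Quotient.mk_surjective x
  refine ⟨f, congrArg (Ideal.Quotient.mk _) (Subtype.ext ?_)⟩
  exact (hη.mem_jacCoord_iff h f).1 hf

lemma IsNormalizer.toIdealsCoord_eq_zero_iff (hη : IsNormalizer O p₀ η) (h : HasUnitConst η)
    (n : Fin d → ℕ) (f : UnitCoord O) :
    hη.toIdealsCoord h n f = 0 ↔ normalHom η h f ∈ shiftIdeal O n :=
  Ideal.Quotient.eq_zero_iff_mem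

/-- The condition `t^n μ ∈ 𝒪` is stable under multiplication of `μ` by points of `𝒪`; it is tested
at the universal point `κ` of the closed subscheme. -/
lemma IsNormalizer.normalHom_mem_shiftIdeal (hη : IsNormalizer O p₀ η) (h : HasUnitConst η)
    (n : Fin d → ℕ) {f : UnitCoord O} (hf : f ∈ shiftIdeal O n) :
    normalHom η h f ∈ shiftIdeal O n := by
  let κ := Ideal.Quotient.mkₐ k (shiftIdeal O n)
  have h1 : ∀ f ∈ shiftIdeal O n, κ f = 0 := fun f hf => Ideal.Quotient.eq_zero_iff_mem.2 hf
  have h2 : ∀ f ∈ shiftIdeal O n, κ.comp (normalHom η h) f = 0 := by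
    rw [forall_shiftIdeal_eq_zero_iff] at h1 ⊢
    simp only [AlgHom.comp_apply]
    rw [comp_normalHom_coord]
    exact mulCoeff_mem_shiftSpace h1 (baseSpan_map κ hη.mem)
  exact Ideal.Quotient.eq_zero_iff_mem.1 (h2 f hf)

/-- The coordinate ring of `ℐ_n` represents the points in normal form. -/
lemma IsNormalizer.isUniversal_normalPoints (hη : IsNormalizer O p₀ η) (h : HasUnitConst η)
    (n : Fin d → ℕ) :
    IsUniversal (normalPoints p₀ n) (IdealsCoord O n)
      fun p => hη.toIdealsCoord h n (coord O p) where
  map_mem φ := by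
    let q := hη.toIdealsCoord h n
    have hq : q.comp (normalHom η h) = q := by
      refine AlgHom.ext fun f => ?_
      exact congrArg (Ideal.Quotient.mk _) (Subtype.ext (hη.normalHom_normalHom h f))
    have h1 : (fun p => φ (q (coord O p))) =
        mulCoeff (fun p => φ.comp q (coord O p)) fun p => φ.comp q (η p) := by
      rw [← comp_normalHom_coord h (φ.comp q)]
      ext p
      exact congrArg φ (DFunLike.congr_fun hq _).symm
    refine ⟨?_, hasUnitConst_point (φ.comp q), ?_⟩
    · rw [h1]
      exact hη.isNormal_comp (φ.comp q)
    · refine (forall_shiftIdeal_eq_zero_iff (φ.comp q)).1 fun f hf => ?_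
      rw [AlgHom.comp_apply, (hη.toIdealsCoord_eq_zero_iff h n f).2
        (hη.normalHom_mem_shiftIdeal h n hf), map_zero]
  lift w hw := by
    let g := pointOf w hw.2.1
    have hg : (fun p => g (coord O p)) = w := funext fun p => pointOf_coord w hw.2.1 p
    have hI := (forall_shiftIdeal_eq_zero_iff (n := n) g).2 (hg.symm ▸ hw.2.2)
    -- A normal point is fixed by the retraction, so it can be recovered from its values on the
    -- invariant functions.
    have hν := hη.comp_normalHom_of_isNormal h g (hg.symm ▸ hw.1)
    refine ⟨Ideal.Quotient.liftₐ _ (g.comp (jacCoord O).val) fun f hf => hI _ hf, fun p => ?_⟩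
    exact (DFunLike.congr_fun hν _).trans (congrFun hg p)
  ext φ ψ H := by
    have : φ.comp (hη.toIdealsCoord h n) = ψ.comp (hη.toIdealsCoord h n) :=
      UnitCoord.hom_ext H
    exact (AlgHom.cancel_right (hη.toIdealsCoord_surjective h n)).1 this

/-- The map `(ν, h) ↦ ν h` from pairs of a point of `ℐ_n` in normal form and a point `h` of
`𝒪ˣ / (1 + ℱ)` with `h_{p₀} = 1`, onto the points with `p₀`-coordinate `1`. -/
lemma isUniversal_tensor {B C : Type u} [CommRing B] [Algebra k B] [CommRing C] [Algebra k C]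
    {u : Pos O → B} {w : Pos O → C} (n : Fin d → ℕ) (hO : HasEqualConst O)
    (hp₀ : ∀ q : Pos O, p₀.rank ≤ q.rank)
    (hu : IsUniversal (normalPoints p₀ n) B u)
    (hw : IsUniversal (slicePoints (truncSpace O) p₀ ∅) C w) :
    IsUniversal (slicePoints (shiftSpace O n) p₀ {p : Pos O | (p.2 : ℕ) = 0 ∧ p ≠ p₀})
      (B ⊗[k] C) (mulCoeff (fun p => (Algebra.TensorProduct.includeLeft : B →ₐ[k] B ⊗[k] C) (u p))
        fun p => (Algebra.TensorProduct.includeRight : C →ₐ[k] B ⊗[k] C) (w p)) := by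
  let iL : B →ₐ[k] B ⊗[k] C := Algebra.TensorProduct.includeLeft
  let iR : C →ₐ[k] B ⊗[k] C := Algebra.TensorProduct.includeRight
  have h0 := exp_eq_zero_of_isMin hp₀
  have hmap : ∀ {R : Type u} [CommRing R] [Algebra k R] (φ : B ⊗[k] C →ₐ[k] R),
      (fun p => φ (mulCoeff (fun p => iL (u p))
        (fun p => iR (w p)) p)) =
      mulCoeff (fun p => φ.comp iL (u p))
        (fun p => φ.comp iR (w p)) := fun φ =>
    funext fun p => map_mulCoeff φ.toRingHom _ _ p
  refine ⟨fun {R} _ _ φ => ?_, fun {R} _ _ x hx => ?_, fun {R} _ _ φ ψ H => ?_⟩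
  · rw [hmap]
    obtain ⟨hn, hun, hs⟩ := hu.map_mem (φ.comp iL)
    obtain ⟨ht, ht0, -⟩ := hw.map_mem (φ.comp iR)
    refine ⟨mulCoeff_mem_shiftSpace hs ht, ?_, fun p hp => ?_⟩
    · rw [mulCoeff_apply_of_exp_eq_zero _ _ h0, hn.apply_self hp₀, one_mul]
      exact ht0
    · exact hun.mulCoeff (hO.hasUnitConst_of_eq_one h0 ht ht0) p (by simp_all)
  · obtain ⟨hs, hx0, hxu⟩ := hx
    have hun : HasUnitConst x := fun p hp => by
      by_cases hpp : p = p₀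
      · rw [hpp, hx0]
        exact isUnit_one
      · exact hxu p (by simp [hp, hpp])
    -- The factors of `x` are `ν = x z` and `h = y = z⁻¹`, with `z` the normalizer of `x`; `z`, and
    -- with it `y`, has `p₀`-coordinate `1` because `x` does.
    obtain ⟨z, ⟨hz, hz'⟩, -⟩ := existsUnique_mulCoeff_eq x hun
      (fun p => if (p : Pos O) = p₀ then 1 else 0)
    have hnz : IsNormal p₀ (mulCoeff x z) := hz'
    have hz0 : z p₀ = 1 := by
      have := hnz.apply_self hp₀
      rwa [mulCoeff_apply_of_exp_eq_zero _ _ h0, hx0, one_mul] at this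
    have huz := hO.hasUnitConst_of_eq_one h0 hz hz0
    obtain ⟨y, hy, hzy⟩ := hO.exists_inverse hp₀ hz huz
    have hy0 : y p₀ = 1 := by
      have := congrFun hzy p₀
      rw [mulCoeff_apply_of_exp_eq_zero _ _ h0, hz0, one_mul] at this
      rw [this, (hO.isNormal_one R hp₀).apply_self hp₀]
    obtain ⟨φ, hφ⟩ := hu.lift (mulCoeff x z)
      ⟨hnz, hun.mulCoeff huz, mulCoeff_mem_shiftSpace hs hz⟩
    obtain ⟨ψ, hψ⟩ := hw.lift y ⟨hy, hy0, by simp⟩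
    let χ : B ⊗[k] C →ₐ[k] R := Algebra.TensorProduct.lift φ ψ fun _ _ => .all _ _
    have hL : ∀ p, χ.comp iL (u p) = mulCoeff x z p := fun p => by simp [χ, iL, hφ]
    have hR : ∀ p, χ.comp iR (w p) = y p := fun p => by simp [χ, iR, hψ]
    refine ⟨χ, fun p => (congrFun (hmap χ) p).trans ?_⟩
    rw [funext hL, funext hR, mulCoeff_assoc, hzy, mulCoeff_one]
  · obtain ⟨hn, hun, -⟩ := hu.map_mem (φ.comp iL)
    obtain ⟨ht, ht0, -⟩ := hw.map_mem (φ.comp iR)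
    obtain ⟨hn', hun', -⟩ := hu.map_mem (ψ.comp iL)
    obtain ⟨ht', ht0', -⟩ := hw.map_mem (ψ.comp iR)
    have huh := hO.hasUnitConst_of_eq_one h0 ht ht0
    have huh' := hO.hasUnitConst_of_eq_one h0 ht' ht0'
    obtain ⟨z, hz, hz1⟩ := hO.exists_inverse hp₀ ht huh
    obtain ⟨z', hz', hz1'⟩ := hO.exists_inverse hp₀ ht' huh'
    have hprod := (hmap φ).symm.trans ((funext H).trans (hmap ψ))
    -- The inverses of the two second factors both normalize the common product.
    have hzz : z = z' := by
      refine eq_of_isNormal_mulCoeff (p₀ := p₀) (hun.mulCoeff huh) hz hz' ?_ ?_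
      · rwa [mulCoeff_assoc, hz1, mulCoeff_one]
      · rwa [hprod, mulCoeff_assoc, hz1', mulCoeff_one]
    have h1 := congrArg (mulCoeff · z) hprod
    simp only [mulCoeff_assoc, hz1] at h1
    rw [hzz, hz1', mulCoeff_one, mulCoeff_one] at h1
    have h2 : ∀ a b c : Pos O → R, mulCoeff a c = truncate O 1 → mulCoeff b c = truncate O 1 →
        a = b := fun a b c ha hb => by
      rw [← mulCoeff_one a, ← hb, mulCoeff_comm b, ← mulCoeff_assoc, ha, mulCoeff_comm, mulCoeff_one]
    have h3 := h2 _ _ _ hz1 (hzz ▸ hz1')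
    exact Algebra.TensorProduct.ext (hu.ext _ _ (congrFun h1)) (hw.ext _ _ (congrFun h3))

/-- Classes of the two sides of `isUniversal_tensor`. The power of `𝕃` is the class of the affine
space of the factors `h`, the case of no hyperplanes. -/
lemma HasEqualConst.idealsClass_mul (hO : HasEqualConst O)
    (hp₀ : ∀ q : Pos O, p₀.rank ≤ q.rank) (n : Fin d → ℕ) :
    idealsClass O n *
        lefschetz k ^ (Nat.card (leading (Pos.rank (O := O)) (truncSpace O)) - 1) =
      sliceClass (Pos.rank (O := O)) (shiftSpace O n) p₀ {p : Pos O | (p.2 : ℕ) = 0 ∧ p ≠ p₀} := by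
  obtain ⟨η, hη⟩ := exists_isNormalizer (p₀ := p₀)
  have h := hη.hasUnitConst hO hp₀
  obtain ⟨A, _, _, u, hu, _, hA⟩ := exists_isUniversal_slicePoints Pos.rank_injective hp₀
    (shiftSpace O n) {p : Pos O | (p.2 : ℕ) = 0 ∧ p ≠ p₀}
  obtain ⟨C, _, _, w, hw, _, hC⟩ := exists_isUniversal_slicePoints Pos.rank_injective hp₀
    (truncSpace O) ∅
  have : Algebra.FiniteType k (UnitCoord O) :=
    .trans (S := MvPolynomial (Pos O) k) inferInstance
      (IsLocalization.finiteType_of_monoid_fg (.powers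
        (∏ p : Pos O with (p.2 : ℕ) = 0, (MvPolynomial.X p : MvPolynomial (Pos O) k))) _)
  have : Algebra.FiniteType k (IdealsCoord O n) :=
    .of_surjective _ (hη.toIdealsCoord_surjective h n)
  obtain ⟨e⟩ := hu.nonempty_algEquiv
    (isUniversal_tensor n hO hp₀ (hη.isUniversal_normalPoints h n) hw)
  rw [← hA, affineClass_congr e, affineClass_tensor, hC, sliceClass]
  simp [kerOn_empty, mem_leading_truncSpace hp₀, idealsClass]

/-- Without positions `G` is a point, and so is `ℐ_n`. -/
lemma idealsClass_of_isEmpty [IsEmpty (Pos O)] (n : Fin d → ℕ) : idealsClass O n = 1 := by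
  have hunit : HasUnitConst (isEmptyElim : Pos O → k) := fun p => isEmptyElim p
  have hsurj : Function.Surjective (algebraMap k (UnitCoord O)) := by
    let g : UnitCoord O →ₐ[k] k := pointOf isEmptyElim hunit
    have : (Algebra.ofId k (UnitCoord O)).comp g = AlgHom.id k _ :=
      UnitCoord.hom_ext fun p => isEmptyElim p
    exact fun f => ⟨g f, DFunLike.congr_fun this f⟩
  have hI : shiftIdeal O n = ⊥ := by
    refine eq_bot_iff.2 (Ideal.span_le.2 ?_)
    rintro _ ⟨l, -, rfl⟩
    simp
  have : Nontrivial (UnitCoord O) := (pointOf isEmptyElim hunit).toRingHom.domain_nontrivial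
  have hbij : Function.Bijective (Algebra.ofId k (IdealsCoord O n)) := by
    have : Nontrivial (IdealsCoord O n) := Ideal.Quotient.nontrivial_iff.2 fun h => by
      have := (Ideal.eq_top_iff_one _).1 h
      rw [hI] at this
      exact one_ne_zero (α := UnitCoord O) this
    refine ⟨(algebraMap k (IdealsCoord O n)).injective, fun x => ?_⟩
    obtain ⟨⟨f, hf⟩, rfl⟩ := Ideal.Quotient.mk_surjective x
    obtain ⟨a, rfl⟩ := hsurj f
    exact ⟨a, rfl⟩
  rw [idealsClass, ← affineClass_congr (AlgEquiv.ofBijective _ hbij), affineClass_self]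

end Jacobian

/-! ### Dimensions read off from the semigroup of values. -/

section Semigroup

variable {k : Type u} [Field k] {d : ℕ} {O : Subalgebra k (Fin d → k⟦X⟧)}

variable (O) in
/-- The ring `𝒪` contains an ideal `t^N 𝒪~`. -/
def HasConductor : Prop :=
  ∃ N : ℕ, ∀ z : Fin d → k⟦X⟧, (∀ i, (N : ℕ∞) ≤ (z i).order) → z ∈ O

/-- Lowest terms of `z` are cancelled by elements of `𝒪` with prescribed values until all orders
reach `N`. -/
lemma HasConductor.mem_of_forall_le_order (hO : HasConductor O) {a : Fin d → ℕ}
    (ha : ∀ m, a ≤ m → m ∈ valueSemigroup O) (z : Fin d → k⟦X⟧)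
    (hz : ∀ i, (a i : ℕ∞) ≤ (z i).order) : z ∈ O := by
  obtain ⟨N, hN⟩ := hO
  -- The induction runs on the total amount by which the orders of the components fall short of `N`.
  let e : (Fin d → k⟦X⟧) → ℕ := fun z => ∑ i, (N - (min (N : ℕ∞) (z i).order).toNat)
  induction hs : e z using Nat.strong_induction_on generalizing z with
  | _ s ih =>
    by_cases h : ∀ i, (N : ℕ∞) ≤ (z i).order
    · exact hN z h
    push Not at h
    obtain ⟨i, hi⟩ := h
    obtain ⟨j, hj⟩ := ENat.ne_top_iff_exists.1 hi.ne_top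
    -- With value `j` at `i` and at least `N` elsewhere, a multiple of `y` cancels the lowest term
    -- at `i` without increasing the deficit of any other component.
    obtain ⟨y, hy, hyo⟩ := ha (Function.update (fun l => max N (a l)) i j) (fun l => by
      by_cases hl : l = i
      · subst hl
        have := hz l
        rw [← hj] at this
        simpa using this
      · simp [hl])
    have hyi : (y i).order = j := by simpa using hyo i
    have hyl : ∀ l, l ≠ i → (N : ℕ∞) ≤ (y l).order ∧ (a l : ℕ∞) ≤ (y l).order := fun l hl => by
      rw [hyo l]
      simp [hl]
    have hyi' := (PowerSeries.order_eq_nat.1 hyi)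
    have hzi' := (PowerSeries.order_eq_nat.1 hj.symm)
    set α := PowerSeries.coeff j (z i) * (PowerSeries.coeff j (y i))⁻¹ with hα
    have hord : ((j + 1 : ℕ) : ℕ∞) ≤ ((z - α • y) i).order := by
      refine PowerSeries.le_order _ _ fun l hl => ?_
      have hl' : l < j + 1 := by exact_mod_cast hl
      rcases (Nat.lt_succ_iff_lt_or_eq.1 hl') with h | rfl
      · simp [hyi'.2 l h, hzi'.2 l h]
      · simp [hα, hyi'.1]
    have hordl : ∀ l, min (z l).order (y l).order ≤ ((z - α • y) l).order := fun l => by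
      have h1 := PowerSeries.min_order_le_order_add (z l) (-(α • y l))
      have h2 : (y l).order ≤ (-(α • y l)).order := by
        rw [PowerSeries.order_neg]
        exact PowerSeries.le_order_smul
      have h3 : (z - α • y) l = z l + -(α • y l) := by simp [sub_eq_add_neg]
      rw [h3]
      exact (min_le_min_left _ h2).trans h1
    have hmem : z - α • y ∈ O := by
      refine ih (e (z - α • y)) ?_ _ (fun l => ?_) rfl
      · rw [← hs]
        have hmono : ∀ l, min (N : ℕ∞) (z l).order ≤ min (N : ℕ∞) ((z - α • y) l).order := by
          intro l
          refine le_min (min_le_left _ _) ?_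
          by_cases hl : l = i
          · subst hl
            refine (min_le_right _ _).trans (le_trans ?_ hord)
            rw [← hj]
            exact_mod_cast Nat.le_succ j
          · exact le_trans (le_min (min_le_right _ _) ((min_le_left _ _).trans (hyl l hl).1))
              (hordl l)
        have hfin : ∀ x : k⟦X⟧, min (N : ℕ∞) x.order ≠ ⊤ := fun x =>
          ne_top_of_le_ne_top (ENat.natCast_ne_top N) (min_le_left _ _)
        refine Finset.sum_lt_sum (fun l _ => Nat.sub_le_sub_left
          (ENat.toNat_le_toNat (hmono l) (hfin _)) _) ⟨i, Finset.mem_univ i, ?_⟩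
        have hjN : j < N := by
          rw [← hj] at hi
          exact_mod_cast hi
        have h1 : (min (N : ℕ∞) (z i).order).toNat = j := by
          rw [← hj, min_eq_right (by exact_mod_cast hjN.le)]
          rfl
        have h2 : j + 1 ≤ (min (N : ℕ∞) ((z - α • y) i).order).toNat := by
          rw [← ENat.natCast_le_natCast, ENat.natCast_toNat (hfin _)]
          exact le_min (by exact_mod_cast hjN) hord
        omega
      · by_cases hl : l = i
        · subst hl
          refine (hz l).trans (le_trans ?_ hord)
          rw [← hj]
          exact_mod_cast Nat.le_succ j
        · exact (le_min (hz l) (hyl l hl).2).trans (hordl l)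
    have := O.add_mem hmem (O.smul_mem hy α)
    rwa [sub_add_cancel] at this

/-- The conductor ideal `t^c 𝒪~` is contained in `𝒪`. -/
lemma HasConductor.mem_of_conductor_le_order (hO : HasConductor O) (z : Fin d → k⟦X⟧)
    (hz : ∀ i, (conductor O i : ℕ∞) ≤ (z i).order) : z ∈ O := by
  have hne : {n : Fin d → ℕ | ∀ m, n ≤ m → m ∈ valueSemigroup O}.Nonempty := by
    obtain ⟨N, hN⟩ := hO
    refine ⟨fun _ => N, fun m hm => ⟨fun i => PowerSeries.X ^ m i, hN _ fun i => ?_, fun i => ?_⟩⟩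
    · rw [PowerSeries.order_X_pow]
      exact_mod_cast hm i
    · rw [PowerSeries.order_X_pow]
  -- The conductor is a componentwise infimum, so for each `i` some admissible `a` has `a i = c_i`.
  -- Its other entries do not matter, as the other components here are zero, of order `⊤`.
  have hsingle : ∀ i, Pi.single i (z i) ∈ O := fun i => by
    have hmem : conductor O i ∈ (fun n : Fin d → ℕ => n i) ''
        {n | ∀ m, n ≤ m → m ∈ valueSemigroup O} := by
      have : conductor O i = sInf ((fun n : Fin d → ℕ => n i) ''
          {n | ∀ m, n ≤ m → m ∈ valueSemigroup O}) := by
        rw [conductor, sInf_apply, sInf_image']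
      rw [this]
      exact Nat.sInf_mem (hne.image _)
    obtain ⟨a, ha, hai⟩ := hmem
    refine hO.mem_of_forall_le_order ha _ fun l => ?_
    by_cases hl : l = i
    · subst hl
      simpa [hai] using hz l
    · simp [hl]
  have : z = ∑ i, Pi.single i (z i) := (Finset.univ_sum_single z).symm
  rw [this]
  exact O.sum_mem fun i _ => hsingle i

/-- The conductor of a semigroup of values. -/
def semigroupConductor (S : AddSubmonoid (Fin d → ℕ)) : Fin d → ℕ :=
  sInf {n | ∀ m, n ≤ m → m ∈ S}

/-- The positions below the conductor. -/
abbrev SPos (S : AddSubmonoid (Fin d → ℕ)) : Type := Σ i : Fin d, Fin (semigroupConductor S i)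

/-- The rank of a position: smaller exponents first. -/
def SPos.rank {S : AddSubmonoid (Fin d → ℕ)} (p : SPos S) : ℕ := p.2 * d + p.1

/-- There is an element of `S` which is at least `n`, whose value on the component of `p` is
`n + p`, and whose values exceed `n + q` for all `q` before `p` and all `q` in `J`. -/
def IsLead (S : AddSubmonoid (Fin d → ℕ)) (n : Fin d → ℕ) (J : Finset (SPos S)) (p : SPos S) :
    Prop :=
  ∃ m ∈ S, n ≤ m ∧ m p.1 = n p.1 + p.2 ∧ (∀ q : SPos S, q.rank < p.rank → n q.1 + q.2 < m q.1) ∧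
    ∀ q ∈ J, n q.1 + q.2 < m q.1

lemma lt_order_iff {x : k⟦X⟧} {j : ℕ} :
    (j : ℕ∞) < x.order ↔ ∀ l ≤ j, PowerSeries.coeff l x = 0 := by
  constructor
  · intro h l hl
    exact PowerSeries.coeff_of_lt_order l (lt_of_le_of_lt (by exact_mod_cast hl) h)
  · intro h
    refine lt_of_lt_of_le (b := ((j + 1 : ℕ) : ℕ∞)) (by exact_mod_cast Nat.lt_succ_self j)
      (PowerSeries.le_order _ _ fun l hl => h l ?_)
    exact Nat.lt_succ_iff.1 (by exact_mod_cast hl)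

/-- The leading positions of `{w | t^n w ∈ 𝒪, w_J = 0}` are determined by the semigroup of
values. -/
lemma HasConductor.mem_leading_iff (hO : HasConductor O) {n : Fin d → ℕ} {J : Finset (Pos O)}
    (hJ : ∀ q ∈ J, (q.2 : ℕ) = 0) {p : Pos O} :
    p ∈ leading (Pos.rank (O := O)) (kerOn (shiftSpace O n) J) ↔
      IsLead (valueSemigroup O) n J p := by
  classical
  constructor
  · rintro ⟨w, ⟨hw, hwJ⟩, hp, hlt⟩
    obtain ⟨z, hz, hzw⟩ := hw
    -- A lift of `w` with all components nonzero, so that its value exists: a zero component becomes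
    -- `t_i^{c_i}`, invisible below the conductor.
    let V : Fin d → k⟦X⟧ := fun i =>
      let W : k⟦X⟧ := PowerSeries.mk fun j => if h : j < conductor O i then w ⟨i, j, h⟩ else 0
      if W = 0 then PowerSeries.X ^ conductor O i else W
    have hVw : ∀ q : Pos O, PowerSeries.coeff (q.2 : ℕ) (V q.1) = w q := by
      intro q
      by_cases h : (PowerSeries.mk fun j => if h : j < conductor O q.1 then w ⟨q.1, j, h⟩ else 0) =
        (0 : k⟦X⟧)
      · have := congrArg (PowerSeries.coeff (q.2 : ℕ)) h
        simp only [PowerSeries.coeff_mk, q.2.2, dite_true, map_zero] at this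
        simp only [V, h, if_true, PowerSeries.coeff_X_pow, q.2.2.ne, if_false]
        exact this.symm
      · simp [V, h]
    have hV0 : ∀ i, V i ≠ 0 := fun i => by
      dsimp only [V]
      split_ifs with h
      · exact pow_ne_zero _ PowerSeries.X_ne_zero
      · exact h
    have hVtr : truncate O V = w := funext hVw
    choose o ho using fun i => ENat.ne_top_iff_exists.1
      (mt PowerSeries.order_eq_top.1 (hV0 i))
    -- `t^n V` agrees with `z ∈ 𝒪` below the conductor, and `ℱ ⊆ 𝒪`.
    have hmem : (fun i => PowerSeries.X ^ n i * V i) ∈ O := by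
      have hd : (fun i => PowerSeries.X ^ n i * V i) - z ∈ O := by
        refine hO.mem_of_conductor_le_order _ fun i => PowerSeries.le_order _ _ fun j hj => ?_
        have hj' : j < conductor O i := by exact_mod_cast hj
        have h1 := congrFun (shift_truncate (O := O) n V) ⟨i, j, hj'⟩
        have h2 := congrFun hzw ⟨i, j, hj'⟩
        rw [hVtr, h2] at h1
        simp only [truncate] at h1
        rw [Pi.sub_apply, map_sub, ← h1, sub_self]
      simpa using O.add_mem hd hz
    have hsub : ∀ q : Pos O, (∀ l (hl : l ≤ (q.2 : ℕ)),
        w ⟨q.1, l, hl.trans_lt q.2.2⟩ = 0) → (q.2 : ℕ) < o q.1 := fun q hq => by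
      have : ((q.2 : ℕ) : ℕ∞) < (V q.1).order := lt_order_iff.2 fun l hl =>
        (hVw ⟨q.1, l, hl.trans_lt q.2.2⟩).trans (hq l hl)
      rw [← ho] at this
      exact_mod_cast this
    refine ⟨fun i => n i + o i, ⟨_, hmem, fun i => ?_⟩, fun i => Nat.le_add_right _ _, ?_,
      fun q hq => ?_, fun q hq => ?_⟩
    · rw [PowerSeries.order_mul, PowerSeries.order_X_pow, ← ho]
      push_cast
      rfl
    · have : (V p.1).order = (p.2 : ℕ) := PowerSeries.order_eq_nat.2 ⟨by rwa [hVw],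
        fun l hl => (hVw ⟨p.1, l, hl.trans p.2.2⟩).trans (hlt _ (Pos.rank_lt rfl hl))⟩
      rw [← ho] at this
      exact congrArg (n p.1 + ·) (by exact_mod_cast this)
    · refine Nat.add_lt_add_left (hsub q fun l hl => hlt _ (lt_of_le_of_lt ?_ hq)) _
      rcases hl.lt_or_eq with hl | rfl
      · exact (Pos.rank_lt (p := q) (q := ⟨q.1, l, hl.trans q.2.2⟩) rfl hl).le
      · exact le_rfl
    -- Positions in `J` have exponent zero, so one vanishing coordinate already forces the order
    -- above it.
    · refine Nat.add_lt_add_left (hsub q fun l hl => ?_) _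
      obtain ⟨i, j, hj⟩ := q
      obtain rfl : j = 0 := hJ _ hq
      obtain rfl : l = 0 := Nat.le_zero.1 hl
      exact hwJ _ hq
  · rintro ⟨m, ⟨z, hz, hzm⟩, hnm, hmp, hlt, hmJ⟩
    -- This is `t^{-n} z`, a power series tuple because `n ≤ m`.
    let W : Fin d → k⟦X⟧ := fun i => PowerSeries.mk fun j => PowerSeries.coeff (j + n i) (z i)
    have hW : (fun i => PowerSeries.X ^ n i * W i) = z := by
      ext i j
      rw [PowerSeries.coeff_X_pow_mul']
      split_ifs with h
      · simp [W, Nat.sub_add_cancel h]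
      · refine (PowerSeries.coeff_of_lt_order _ ?_).symm
        rw [hzm]
        exact_mod_cast (not_le.1 h).trans_le (hnm i)
    have hzero : ∀ q : Pos O, n q.1 + q.2 < m q.1 → truncate O W q = 0 := fun q hq => by
      simp only [truncate, W, PowerSeries.coeff_mk]
      refine PowerSeries.coeff_of_lt_order _ ?_
      rw [hzm, add_comm]
      exact_mod_cast hq
    refine ⟨truncate O W, ⟨?_, fun q hq => hzero q (hmJ q hq)⟩, ?_, fun q hq => hzero q (hlt q hq)⟩
    · change shift n (truncate O W) ∈ truncSpace O
      rw [shift_truncate, hW]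
      exact truncate_mem_truncSpace hz
    · simp only [truncate, W, PowerSeries.coeff_mk]
      rw [add_comm, ← hmp]
      exact (PowerSeries.order_eq_nat.1 (hzm p.1)).1

open Classical in
/-- The class of the complement of the hyperplane arrangement attached to `n`, as a polynomial
in `U`. -/
def arrangementPoly (S : AddSubmonoid (Fin d → ℕ)) (n : Fin d → ℕ) : ℤ[T;T⁻¹] :=
  ∑ J ∈ Finset.powerset {p : SPos S | (p.2 : ℕ) = 0 ∧ ∃ q : SPos S, q.rank < p.rank},
    (-1) ^ J.card * if ∃ p : SPos S, (∀ q : SPos S, p.rank ≤ q.rank) ∧ IsLead S n J p then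
      LaurentPolynomial.T ((Nat.card {p // IsLead S n J p} - 1 : ℕ) : ℤ) else 0

open Classical in
/-- The universal zeta function, with coefficients in the Laurent polynomials in `U`. -/
def universalZeta (d : ℕ) (S : AddSubmonoid (Fin d → ℕ)) :
    MvPowerSeries (Fin d) ℤ[T;T⁻¹] := fun n =>
  if (n : Fin d → ℕ) ∈ S then
    -- The number of leads for `0` and `∅` is `dim 𝒪/ℱ`, so the negative power removes the factor
    -- from `HasEqualConst.idealsClass_mul`. Without positions the class is `1`.
    (if IsEmpty (SPos S) then 1 else arrangementPoly S n *
      LaurentPolynomial.T (-((Nat.card {p // IsLead S 0 ∅ p} - 1 : ℕ) : ℤ))) *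
      LaurentPolynomial.T (-((∑ i, n i : ℕ) : ℤ))
  else 0

lemma substLefschetz_T (m : ℤ) :
    substLefschetz k (LaurentPolynomial.T m) = ((lefschetzUnit k ^ m : (MotivicRing k)ˣ) : _) := by
  simp [substLefschetz]

lemma algebraMap_lefschetz :
    algebraMap (K0 k) (MotivicRing k) (lefschetz k) = lefschetzUnit k := rfl

lemma shiftSpace_zero : shiftSpace O 0 = truncSpace O := by
  have : shift (O := O) (R := k) 0 = LinearMap.id := by
    ext
    simp [shift_apply]
  rw [shiftSpace, this, Submodule.comap_id]

lemma HasConductor.card_leading (hO : HasConductor O) {n : Fin d → ℕ} {J : Finset (Pos O)}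
    (hJ : ∀ q ∈ J, (q.2 : ℕ) = 0) :
    Nat.card (leading (Pos.rank (O := O)) (kerOn (shiftSpace O n) J)) =
      Nat.card {p // IsLead (valueSemigroup O) n J p} :=
  Nat.card_congr (Equiv.subtypeEquivRight fun _ => hO.mem_leading_iff hJ)

/-- `SPos` of the value semigroup is `Pos O` by definition, and the sums match term by term; on the
semigroup side `p₀` is described only as the position of least rank. -/
lemma HasConductor.subst_arrangementPoly (hO : HasConductor O) (n : Fin d → ℕ) {p₀ : Pos O}
    (hp₀ : ∀ q : Pos O, p₀.rank ≤ q.rank) :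
    substLefschetz k (arrangementPoly (valueSemigroup O) n) =
      algebraMap (K0 k) (MotivicRing k) (sliceClass (Pos.rank (O := O)) (shiftSpace O n) p₀
        {p : Pos O | (p.2 : ℕ) = 0 ∧ p ≠ p₀}) := by
  classical
  rw [arrangementPoly, sliceClass, map_sum, map_sum]
  refine Finset.sum_congr ?_ fun J hJ => ?_
  · congr 1
    ext p
    simp only [Finset.mem_filter, Finset.mem_univ, true_and]
    refine Iff.trans (and_congr_right fun _ => ⟨?_, ?_⟩)
      (Finset.mem_filter_univ (p := fun p : Pos O => (p.2 : ℕ) = 0 ∧ p ≠ p₀) p).symm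
    · rintro ⟨q, hq⟩ rfl
      exact absurd (hp₀ q) (not_le.2 hq)
    · exact fun h => ⟨p₀, lt_of_le_of_ne (hp₀ p) fun h' => h (Pos.rank_injective h'.symm)⟩
  · have hJ' : ∀ q ∈ J, (q.2 : ℕ) = 0 := fun q hq =>
      (Finset.mem_filter.1 (Finset.mem_powerset.1 hJ hq)).2.1
    have hiff : (∃ p : SPos (valueSemigroup O), (∀ q : SPos (valueSemigroup O),
        p.rank ≤ q.rank) ∧ IsLead (valueSemigroup O) n J p) ↔
        p₀ ∈ leading (Pos.rank (O := O)) (kerOn (shiftSpace O n) J) := by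
      rw [hO.mem_leading_iff hJ']
      refine ⟨?_, fun h => ⟨p₀, hp₀, h⟩⟩
      rintro ⟨p, hp, h⟩
      obtain rfl : p = p₀ := Pos.rank_injective (O := O) (le_antisymm (hp p₀) (hp₀ p))
      exact h
    rw [hO.card_leading hJ', if_congr hiff rfl rfl, map_mul, map_mul, map_pow, map_pow, map_neg,
      map_neg, map_one, map_one]
    congr 1
    split_ifs
    · rw [substLefschetz_T, map_pow, algebraMap_lefschetz, zpow_natCast, Units.val_pow_eq_pow_val]
    · rw [map_zero, map_zero]

/-- The zeta function is obtained from the universal one attached to the semigroup of values. -/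
lemma HasConductor.zeta_eq (hO : HasConductor O) (hO' : HasEqualConst O) :
    zeta O = MvPowerSeries.map (substLefschetz k) (universalZeta d (valueSemigroup O)) := by
  classical
  ext n
  rw [MvPowerSeries.coeff_map]
  change zeta O n = substLefschetz k (universalZeta d (valueSemigroup O) n)
  rw [zeta, universalZeta]
  split_ifs with hn hempty
  · have : IsEmpty (Pos O) := hempty
    rw [idealsClass_of_isEmpty, one_mul, map_one, one_mul, substLefschetz_T, zpow_neg,
      zpow_natCast, inv_pow]
  · have : Nonempty (Pos O) := not_isEmpty_iff.1 hempty
    obtain ⟨p₀, -, hp₀⟩ := (Set.finite_univ (α := Pos O)).exists_minimalFor Pos.rank _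
      Set.univ_nonempty
    have hmin : ∀ q : Pos O, p₀.rank ≤ q.rank := fun q => (le_total _ _).elim id
      fun h => hp₀ (Set.mem_univ q) h
    have hcard := hO.card_leading (n := 0) (J := ∅) (by simp)
    rw [shiftSpace_zero, kerOn_empty] at hcard
    rw [map_mul, map_mul, hO.subst_arrangementPoly n hmin, ← hO'.idealsClass_mul hmin n, hcard,
      map_mul, map_pow, algebraMap_lefschetz, substLefschetz_T, substLefschetz_T]
    simp only [zpow_neg, zpow_natCast, inv_pow]
    congr 1
    rw [mul_assoc, ← Units.val_pow_eq_pow_val]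
    exact (mul_one _).symm.trans (congrArg _ (Units.mul_inv _).symm)
  · rw [map_zero]

end Semigroup

/-! ### Comparison of the adic and the `t`-adic topology. -/

section Completion

variable {k : Type u} [Field k] {d : ℕ}

lemma exists_mul_eq_X_pow {f : k⟦X⟧} (hf : f ≠ 0) :
    ∃ (e : ℕ) (g : k⟦X⟧), f.order = e ∧ f * g = PowerSeries.X ^ e := by
  refine ⟨f.order.toNat, PowerSeries.Inv_divided_by_X_pow_order hf,
    (ENat.natCast_toNat (mt PowerSeries.order_eq_top.1 hf)).symm, ?_⟩
  have h := congrArg (PowerSeries.X ^ f.order.toNat * ·)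
    (PowerSeries.Inv_divided_by_X_pow_order_rightInv hf)
  rwa [← mul_assoc, PowerSeries.X_pow_order_mul_divXPowOrder, mul_one] at h

lemma mul_single_eq (z : Fin d → k⟦X⟧) (i : Fin d) (a : k⟦X⟧) :
    z * Pi.single i a = Pi.single i (z i * a) := by
  ext1 l
  by_cases hl : l = i
  · subst hl
    simp
  · simp [hl]

lemma exists_dvd_of_forall_ne_zero {y : Fin d → k⟦X⟧} (hy : ∀ i, y i ≠ 0) :
    ∃ N : ℕ, ∀ z : Fin d → k⟦X⟧, (∀ i, (N : ℕ∞) ≤ (z i).order) → y ∣ z := by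
  choose e g _ hg using fun i => exists_mul_eq_X_pow (hy i)
  refine ⟨∑ i, e i, fun z hz => ?_⟩
  have hdvd : ∀ i, PowerSeries.X ^ e i ∣ z i := fun i => by
    refine PowerSeries.X_pow_dvd_iff.2 fun m hm => PowerSeries.coeff_of_lt_order m ?_
    refine lt_of_lt_of_le ?_ (hz i)
    have := Finset.single_le_sum (f := e) (fun _ _ => Nat.zero_le _) (Finset.mem_univ i)
    exact_mod_cast hm.trans_le this
  choose w hw using hdvd
  refine ⟨fun i => g i * w i, funext fun i => ?_⟩
  rw [Pi.mul_apply, ← mul_assoc, hg, hw]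

variable {B : Type u} [CommRing B] {J : Ideal B} {ι : B →+* (Fin d → k⟦X⟧)}
  {π : ∀ n, (Fin d → k⟦X⟧) →+* B ⧸ J ^ n}

/-- The maps `ι : B → 𝒪~` and `π n : 𝒪~ → B / Jⁿ` behave like those of the `J`-adic completion. -/
structure IsCompletionSystem (J : Ideal B) (ι : B →+* (Fin d → k⟦X⟧))
    (π : ∀ n, (Fin d → k⟦X⟧) →+* B ⧸ J ^ n) : Prop where
  apply_ι : ∀ n b, π n (ι b) = Ideal.Quotient.mk _ b
  of_le : ∀ {n m z}, n ≤ m → π m z = 0 → π n z = 0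
  eq_zero : ∀ {z}, (∀ n, π n z = 0) → z = 0

namespace IsCompletionSystem

variable (h : IsCompletionSystem J ι π)

include h

lemma exists_lift (n : ℕ) (z : Fin d → k⟦X⟧) : ∃ b, π n (ι b - z) = 0 := by
  obtain ⟨b, hb⟩ := Ideal.Quotient.mk_surjective (π n z)
  exact ⟨b, by rw [map_sub, h.apply_ι, hb, sub_self]⟩

lemma apply_ι_eq_zero_iff {b : B} : π 1 (ι b) = 0 ↔ b ∈ J := by
  rw [h.apply_ι, Ideal.Quotient.eq_zero_iff_mem, pow_one]

lemma pow_mul_eq_zero {z : Fin d → k⟦X⟧} (hz : π 1 z = 0) (n : ℕ) (w : Fin d → k⟦X⟧) :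
    π n (z ^ n * w) = 0 := by
  rcases Nat.eq_zero_or_pos n with rfl | hn
  · have : Subsingleton (B ⧸ J ^ 0) := Ideal.Quotient.subsingleton_iff.2 (by simp)
    exact Subsingleton.elim _ _
  · obtain ⟨b, hb⟩ := h.exists_lift n z
    have hb1 := h.of_le hn hb
    rw [map_sub, hz, sub_zero, h.apply_ι_eq_zero_iff] at hb1
    rw [map_sub, sub_eq_zero, h.apply_ι] at hb
    rw [map_mul, map_pow, ← hb, ← map_pow,
      Ideal.Quotient.eq_zero_iff_mem.2 (Ideal.pow_mem_pow hb1 n), zero_mul]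

/-- Otherwise the `i`-th idempotent is a multiple of `z`. Being equal to its powers, it is killed by
every `π n`, hence zero. -/
lemma constantCoeff_eq_zero {z : Fin d → k⟦X⟧} (hz : π 1 z = 0) (i : Fin d) :
    PowerSeries.constantCoeff (z i) = 0 := by
  by_contra hne
  let E : Fin d → k⟦X⟧ := Pi.single i 1
  have hE : E = z * Pi.single i (z i)⁻¹ := by
    rw [mul_single_eq, PowerSeries.mul_inv_cancel _ hne]
  have hEE : ∀ n, E ^ n * E = E := fun n => by
    ext1 l
    by_cases hl : l = i
    · subst hl
      simp [E]
    · simp [E, hl]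
  have hE1 : π 1 E = 0 := by rw [hE, map_mul, hz, zero_mul]
  have : E = 0 := h.eq_zero fun n => hEE n ▸ h.pow_mul_eq_zero hE1 n E
  simpa [E] using congrFun this i

/-- Otherwise the kernel of `B → k⟦t_i⟧` contains `J ≠ ⊥`, so it is maximal and the image is a
field; but a lift of `t` maps exactly to `t_i`, which is nonzero and not invertible. -/
lemma exists_apply_ne_zero [IsDomain B] [Ring.DimensionLEOne B] (hJ : J ≠ ⊥) (i : Fin d) :
    ∃ z, π 1 z = 0 ∧ z i ≠ 0 := by
  by_contra! H
  let ev : B →+* k⟦X⟧ := (Pi.evalRingHom _ i).comp ι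
  have hprime : (RingHom.ker ev).IsPrime := RingHom.ker_isPrime ev
  have hJQ : J ≤ RingHom.ker ev := fun b hb => H _ (h.apply_ι_eq_zero_iff.2 hb)
  have hmax : (RingHom.ker ev).IsMaximal :=
    hprime.isMaximal fun hbot => hJ (le_bot_iff.1 (hbot ▸ hJQ))
  obtain ⟨b, hb⟩ := h.exists_lift 1 (fun _ => PowerSeries.X)
  have hbX : ev b = PowerSeries.X := sub_eq_zero.1 (H _ hb)
  obtain ⟨c, q, hq, hcq⟩ := hmax.exists_inv (x := b) fun hb' => by
    rw [RingHom.mem_ker, hbX] at hb'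
    exact PowerSeries.X_ne_zero hb'
  have := congrArg (fun b => PowerSeries.constantCoeff (ev b)) hcq
  simp [(RingHom.mem_ker).1 hq, hbX] at this

/-- A power of `t` is a combination of elements of the kernel of `π 1` that are nonzero in the
respective components, and `J` is radical. -/
lemma apply_X_eq_zero [IsDomain B] [Ring.DimensionLEOne B] (hJ : J ≠ ⊥) (hJ' : J.IsRadical) :
    π 1 (fun _ => PowerSeries.X) = 0 := by
  choose z hz hzi using h.exists_apply_ne_zero hJ
  choose e g _ hg using fun i => exists_mul_eq_X_pow (hzi i)
  set E := ∑ i, e i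
  have hE : ∀ i, e i ≤ E := fun i => Finset.single_le_sum (fun _ _ => Nat.zero_le _)
    (Finset.mem_univ i)
  have hpow : (fun _ => PowerSeries.X : Fin d → k⟦X⟧) ^ E =
      ∑ i, z i * Pi.single i (g i * PowerSeries.X ^ (E - e i)) := by
    rw [← Finset.univ_sum_single ((fun _ => PowerSeries.X : Fin d → k⟦X⟧) ^ E)]
    refine Finset.sum_congr rfl fun i _ => ?_
    rw [mul_single_eq, ← mul_assoc, hg, ← pow_add, Nat.add_sub_of_le (hE i)]
    rfl
  obtain ⟨b, hb⟩ := h.exists_lift 1 (fun _ => PowerSeries.X)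
  rw [map_sub, sub_eq_zero] at hb
  have hbE : π 1 (ι (b ^ E)) = 0 := by
    rw [map_pow, map_pow, hb, ← map_pow, hpow, map_sum]
    exact Finset.sum_eq_zero fun i _ => by rw [map_mul, hz, zero_mul]
  rw [← hb, h.apply_ι_eq_zero_iff]
  exact hJ' ⟨E, h.apply_ι_eq_zero_iff.1 hbE⟩

lemma apply_eq_zero_of_constantCoeff [IsDomain B] [Ring.DimensionLEOne B] (hJ : J ≠ ⊥)
    (hJ' : J.IsRadical) {z : Fin d → k⟦X⟧} (hz : ∀ i, PowerSeries.constantCoeff (z i) = 0) :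
    π 1 z = 0 := by
  choose w hw using fun i => PowerSeries.X_dvd_iff.2 (hz i)
  rw [show z = (fun _ => PowerSeries.X) * w from funext hw, map_mul, h.apply_X_eq_zero hJ hJ',
    zero_mul]

/-- If every kernel contained an element of order below `n` at `i`, then `t_i^n` would lie in every
kernel. -/
lemma exists_forall_le_order (n : ℕ) : ∃ m, ∀ z, π m z = 0 → ∀ i, (n : ℕ∞) ≤ (z i).order := by
  have : ∀ i, ∃ m, ∀ z, π m z = 0 → (n : ℕ∞) ≤ (z i).order := fun i => by
    by_contra! H
    have hs : (Pi.single i (PowerSeries.X ^ n) : Fin d → k⟦X⟧) = 0 := h.eq_zero fun m => by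
      obtain ⟨z, hz, hzn⟩ := H m
      have hz0 : z i ≠ 0 := fun h0 => by simp [h0] at hzn
      obtain ⟨e, g, he, hg⟩ := exists_mul_eq_X_pow hz0
      have hen : e ≤ n := by
        rw [he] at hzn
        exact_mod_cast hzn.le
      rw [show Pi.single i (PowerSeries.X ^ n) = z * Pi.single i (g * PowerSeries.X ^ (n - e)) by
        rw [mul_single_eq, ← mul_assoc, hg, ← pow_add, Nat.add_sub_of_le hen], map_mul, hz, zero_mul]
    simpa using congrFun hs i
  choose m hm using this
  exact ⟨∑ i, m i, fun z hz i => hm i z (h.of_le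
    (Finset.single_le_sum (fun _ _ => Nat.zero_le _) (Finset.mem_univ i)) hz)⟩

lemma exists_approx (n : ℕ) (z : Fin d → k⟦X⟧) :
    ∃ b, ∀ i, (n : ℕ∞) ≤ ((ι b - z) i).order := by
  obtain ⟨m, hm⟩ := h.exists_forall_le_order n
  obtain ⟨b, hb⟩ := h.exists_lift m z
  exact ⟨b, hm _ hb⟩

/-- Nonzero primes are maximal and contain `J`, so an approximation `y ∈ J` of `t` has a power
divisible by `x`, and no component of `ι y` vanishes. -/
lemma ι_apply_ne_zero [IsDomain B] [Ring.DimensionLEOne B] (hJ : J ≠ ⊥) (hJ' : J.IsRadical)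
    (hmax : ∀ Q : Ideal B, Q.IsMaximal → J ≤ Q) {x : B} (hx : x ≠ 0) (i : Fin d) :
    ι x i ≠ 0 := by
  obtain ⟨y, hy⟩ := h.exists_approx 2 (fun _ => PowerSeries.X)
  have hcoeff : ∀ i, ∀ j < 2, PowerSeries.coeff j (ι y i) =
      PowerSeries.coeff j (PowerSeries.X : k⟦X⟧) := fun i j hj => by
    have := PowerSeries.coeff_of_lt_order j (lt_of_lt_of_le (by exact_mod_cast hj) (hy i))
    rwa [Pi.sub_apply, map_sub, sub_eq_zero] at this
  have hyJ : y ∈ J := by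
    rw [← h.apply_ι_eq_zero_iff]
    refine h.apply_eq_zero_of_constantCoeff hJ hJ' fun i => ?_
    rw [← PowerSeries.coeff_zero_eq_constantCoeff_apply, hcoeff i 0 two_pos]
    simp
  have hyi : ι y i ≠ 0 := fun h0 => by
    have := hcoeff i 1 one_lt_two
    simp [h0] at this
  have hrad : y ∈ (Ideal.span {x}).radical := by
    rw [Ideal.radical_eq_sInf, Ideal.mem_sInf]
    rintro Q ⟨hxQ, hQ⟩
    have hxQ' : x ∈ Q := hxQ (Ideal.mem_span_singleton_self x)
    exact hmax Q (hQ.isMaximal fun hbot => hx (by simpa [hbot] using hxQ')) hyJ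
  obtain ⟨M, hM⟩ := hrad
  obtain ⟨b, hb⟩ := Ideal.mem_span_singleton'.1 hM
  intro h0
  have := congrFun (congrArg ι hb) i
  rw [map_mul, Pi.mul_apply, h0, mul_zero, map_pow, Pi.pow_apply] at this
  exact pow_ne_zero M hyi this.symm

variable {A : Type u} [CommRing A] {j : A →+* B}

/-- Equal constant coefficients for the elements which come from a local subring of `B`. -/
lemma constantCoeff_eq [IsLocalRing A] (hj : ∀ a ∈ IsLocalRing.maximalIdeal A, j a ∈ J) {s : k →+* A}
    (hs : ∀ α, ι (j (s α)) = algebraMap k _ α) (a : A) {z : Fin d → k⟦X⟧}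
    (hz : π 1 z = Ideal.Quotient.mk _ (j a)) (i i' : Fin d) :
    PowerSeries.constantCoeff (z i) = PowerSeries.constantCoeff (z i') := by
  set α := PowerSeries.constantCoeff (ι (j a) i) with hα
  have hsα : ∀ l, PowerSeries.constantCoeff (ι (j (s α)) l) = α := fun l => by
    rw [hs, Pi.algebraMap_apply, PowerSeries.algebraMap_apply]
    simp
  -- The image of `a - s α` has constant coefficient zero at `i`, so it is not a unit. It therefore
  -- lies in the maximal ideal, and all its constant coefficients vanish.
  have hmem : a - s α ∈ IsLocalRing.maximalIdeal A := by
    rw [IsLocalRing.mem_maximalIdeal, mem_nonunits_iff]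
    intro hu
    have hu' : IsUnit (PowerSeries.constantCoeff (ι (j (a - s α)) i)) :=
      ((hu.map j).map ι).map
        ((PowerSeries.constantCoeff (R := k)).comp (Pi.evalRingHom (fun _ => k⟦X⟧) i))
    rw [map_sub, map_sub, Pi.sub_apply, map_sub, hsα, sub_self] at hu'
    exact not_isUnit_zero hu'
  have h1 := h.constantCoeff_eq_zero (h.apply_ι_eq_zero_iff.2 (hj _ hmem))
  have h2 : π 1 (z - ι (j a)) = 0 := by rw [map_sub, hz, h.apply_ι, sub_self]
  have h3 : ∀ l, PowerSeries.constantCoeff (z l) = α := fun l => by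
    have h4 := h.constantCoeff_eq_zero h2 l
    have h5 := h1 l
    simp only [map_sub, Pi.sub_apply, sub_eq_zero] at h4 h5
    rw [h4, h5, hsα]
  rw [h3, h3]

/-- If every element of `B` is a quotient of elements of the subring `A`, then a ring which
contains the limits of the power series in a nonzero element `x` of `A`, with coefficients in `A`,
contains an ideal `t^N 𝒪~`. -/
lemma exists_forall_mem [IsDomain B] [Ring.DimensionLEOne B] (hJ' : J.IsRadical)
    (hmax : ∀ Q : Ideal B, Q.IsMaximal → J ≤ Q) {s : k →+* A}
    (hs : ∀ α, ι (j (s α)) = algebraMap k _ α)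
    (hfrac : ∀ b, ∃ y a : A, j y ≠ 0 ∧ j y * b = j a) {x : A} (hx : j x ≠ 0) (hxJ : j x ∈ J) :
    ∃ N : ℕ, ∀ z : Fin d → k⟦X⟧, (∀ i, (N : ℕ∞) ≤ (z i).order) → ∃ c : ℕ → A,
      ∀ n, π n z = Ideal.Quotient.mk _ (j (∑ l ∈ Finset.range n, x ^ l * c l)) := by
  classical
  have hJ : J ≠ ⊥ := fun hbot => hx (by simpa [hbot] using hxJ)
  obtain ⟨E, hE⟩ := exists_dvd_of_forall_ne_zero (h.ι_apply_ne_zero hJ hJ' hmax hx)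
  -- `E` is such that `x` divides `t^E 𝒪~`; the `b p` approximate the monomials `t_i^l`, `l < E`,
  -- modulo `t^E`, and `Y` is a common denominator for them.
  choose b hb using fun p : Fin d × Fin E => h.exists_approx E
    (Pi.single p.1 (PowerSeries.X ^ (p.2 : ℕ)))
  choose y a hy hya using fun p => hfrac (b p)
  set Y := ∏ p, y p
  have hY : j Y ≠ 0 := by
    rw [map_prod]
    exact Finset.prod_ne_zero_iff.2 fun p _ => hy p
  have hYb : ∀ p, j Y * b p = j ((∏ q ∈ Finset.univ.erase p, y q) * a p) := fun p => by
    rw [map_mul, ← hya, ← mul_assoc, ← map_mul, mul_comm _ (y p),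
      Finset.mul_prod_erase _ _ (Finset.mem_univ p)]
  -- Subtracting from `z` the combination of the `b p` given by its coefficients below `E` leaves a
  -- multiple of `x`; multiplication by `Y` moves that combination into `A`.
  have hstep : ∀ z : Fin d → k⟦X⟧, ∃ (c : A) (z' : Fin d → k⟦X⟧),
      ι (j Y) * z = ι (j c) + ι (j x) * (ι (j Y) * z') := by
    intro z
    have hord : ∀ i, (E : ℕ∞) ≤ ((z - ∑ p : Fin d × Fin E,
        algebraMap k _ (PowerSeries.coeff (p.2 : ℕ) (z p.1)) * ι (b p)) i).order := fun i => by
      refine PowerSeries.le_order _ _ fun l hl => ?_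
      have hl' : l < E := by exact_mod_cast hl
      have hcoeff : ∀ p : Fin d × Fin E, PowerSeries.coeff l (ι (b p) i) =
          if p = (i, ⟨l, hl'⟩) then 1 else 0 := fun p => by
        have := PowerSeries.coeff_of_lt_order l (lt_of_lt_of_le hl (hb p i))
        rw [Pi.sub_apply, map_sub, sub_eq_zero] at this
        rw [this]
        obtain ⟨i', l'⟩ := p
        by_cases hi : i = i'
        · subst hi
          simp [PowerSeries.coeff_X_pow, Fin.ext_iff, eq_comm]
        · simp [Ne.symm hi, hi]
      rw [Pi.sub_apply, map_sub, Finset.sum_apply, map_sum]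
      simp only [Pi.mul_apply, Pi.algebraMap_apply, PowerSeries.algebraMap_apply,
        PowerSeries.coeff_C_mul, hcoeff]
      simp
    obtain ⟨z', hz'⟩ := hE _ hord
    refine ⟨∑ p : Fin d × Fin E, s (PowerSeries.coeff (p.2 : ℕ) (z p.1)) *
      ((∏ q ∈ Finset.univ.erase p, y q) * a p), z', ?_⟩
    rw [mul_left_comm, ← hz', mul_sub, map_sum, map_sum, Finset.mul_sum, ← sub_eq_iff_eq_add']
    congr 1
    refine Finset.sum_congr rfl fun p _ => ?_
    rw [map_mul j, map_mul ι, hs, ← hYb, map_mul ι]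
    ring
  choose c f hcf using hstep
  obtain ⟨N, hN⟩ := exists_dvd_of_forall_ne_zero (h.ι_apply_ne_zero hJ hJ' hmax hY)
  refine ⟨N, fun z hz => ?_⟩
  obtain ⟨z, rfl⟩ := hN z hz
  -- Iterating expands `Y z` as a power series in `x` over `A`, with a remainder divisible by `x ^
  -- n` and so killed by `π n`.
  have hsum : ∀ n, ι (j Y) * z = ι (j (∑ l ∈ Finset.range n, x ^ l * c (f^[l] z))) +
      ι (j x) ^ n * (ι (j Y) * f^[n] z) := by
    intro n
    induction n with
    | zero => simp
    | succ n ih =>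
      rw [ih, hcf (f^[n] z), Finset.sum_range_succ, Function.iterate_succ_apply']
      simp only [map_add, map_mul, map_pow]
      ring
  refine ⟨fun l => c (f^[l] z), fun n => ?_⟩
  rw [hsum n, map_add, h.apply_ι, h.pow_mul_eq_zero (h.apply_ι_eq_zero_iff.2 hxJ), add_zero]

end IsCompletionSystem

end Completion

/-! ### Application to the local rings of a curve. -/

section CompletedLocalRings

variable {k : Type u} [Field k] {Y : Scheme.{u}} [IsIntegral Y]
  {f : Y ⟶ Spec (CommRingCat.of k)} {P : Y} {d : ℕ}

/-- The spectrum of the stalk embeds topologically into `Y`. -/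
lemma IsAlgebraicCurve.dimensionLEOne_stalk (hf : IsAlgebraicCurve f) (P : Y) :
    Ring.DimensionLEOne (Y.presheaf.stalk P) := by
  have h : ringKrullDim (Y.presheaf.stalk P) ≤ 1 := by
    rw [← PrimeSpectrum.topologicalKrullDim_eq_ringKrullDim, ← hf.dim_eq_one]
    exact (Y.fromSpecStalk P).isEmbedding.isInducing.topologicalKrullDim_le
  have : Ring.KrullDimLE 1 (Y.presheaf.stalk P) := (Order.krullDimLE_iff _ _).2 (by exact_mod_cast h)
  exact ⟨fun hne hp => hp.isMaximal_of_ne_bot hne⟩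

/-- With zero maximal ideal the stalk would be a principal ideal domain, hence regular. This
supplies the nonzero `x` for the expansion. -/
lemma IsSingular.maximalIdeal_ne_bot (hP : IsSingular P) :
    IsLocalRing.maximalIdeal (Y.presheaf.stalk P) ≠ ⊥ := by
  intro h
  have : IsPrincipalIdealRing (Y.presheaf.stalk P) := by
    refine ⟨fun I => ?_⟩
    by_cases hI : I = ⊤
    · subst hI
      infer_instance
    · obtain rfl : I = ⊥ := le_bot_iff.1 (h ▸ IsLocalRing.le_maximalIdeal hI)
      infer_instance
  exact hP inferInstance

namespace Parametrization

variable (φ : Parametrization f P d)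

/-- The map from the integral closure of the local ring to the product of power series rings. -/
def toPowerSeries : IntClosure P →+* (Fin d → k⟦X⟧) :=
  (φ.equiv : IntClosureCompl P →+* (Fin d → k⟦X⟧)).comp
    (algebraMap (IntClosure P) (IntClosureCompl P))

/-- The reduction of a tuple of power series modulo a power of the Jacobson ideal. -/
def toQuotient (n : ℕ) : (Fin d → k⟦X⟧) →+*
    IntClosure P ⧸ Ideal.jacobson (⊥ : Ideal (IntClosure P)) ^ n :=
  (AdicCompletion.evalₐ (Ideal.jacobson (⊥ : Ideal (IntClosure P))) n :
    IntClosureCompl P →+* _).comp φ.equiv.symm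

lemma isCompletionSystem : IsCompletionSystem _ φ.toPowerSeries φ.toQuotient where
  apply_ι n b := by simp [toPowerSeries, toQuotient]
  of_le {n m z} hnm hz := by
    obtain ⟨y, hy⟩ := AdicCompletion.mk_surjective _ _ (φ.equiv.symm z)
    simp only [toQuotient, RingHom.comp_apply, RingHom.coe_coe, ← hy,
      AdicCompletion.evalₐ_mk] at hz ⊢
    rw [← AdicCompletion.Ideal.mk_eq_mk _ hnm]
    rw [Ideal.Quotient.eq_zero_iff_mem] at hz ⊢
    exact Ideal.pow_le_pow_right hnm hz
  eq_zero {z} hz := by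
    have : φ.equiv.symm z = 0 := AdicCompletion.ext_evalₐ fun n => by
      rw [map_zero]
      exact hz n
    simpa using this

lemma toQuotient_complMap (n : ℕ) (y : AdicCompletion.AdicCauchySequence
      (IsLocalRing.maximalIdeal (Y.presheaf.stalk P)) (Y.presheaf.stalk P)) :
    φ.toQuotient n (φ.equiv (complMap P (AdicCompletion.mk _ _ y))) =
      Ideal.Quotient.mk _ (algebraMap (Y.presheaf.stalk P) (IntClosure P) (y.val n)) := by
  rw [← complMapLevel_mk, toQuotient, RingHom.comp_apply, RingHom.coe_coe, RingHom.coe_coe,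
    RingEquiv.symm_apply_apply, complMap,
    AdicCompletion.evalₐ_liftRingHom _ _ (complMapLevel_comp P)]

lemma hasEqualConst : HasEqualConst φ.localRing := by
  rintro _ ⟨c, rfl⟩ i i'
  obtain ⟨y, rfl⟩ := AdicCompletion.mk_surjective _ _ c
  exact φ.isCompletionSystem.constantCoeff_eq
    (fun a ha => maximalIdeal_le_comap P ha) (s := scalar f P) φ.map_scalar (y.val 1)
    (φ.toQuotient_complMap 1 y) i i'

lemma hasConductor (hf : IsAlgebraicCurve f) (hP : IsSingular P) :
    HasConductor φ.localRing := by
  have := hf.dimensionLEOne_stalk P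
  obtain ⟨x, hx, hx0⟩ := Submodule.exists_mem_ne_zero_of_ne_bot hP.maximalIdeal_ne_bot
  have hinj : Function.Injective (algebraMap (Y.presheaf.stalk P) (IntClosure P)) :=
    FaithfulSMul.algebraMap_injective _ _
  obtain ⟨N, hN⟩ := φ.isCompletionSystem.exists_forall_mem (Ideal.isRadical_jacobson _)
    (fun Q hQ => sInf_le ⟨bot_le, hQ⟩) (s := scalar f P) φ.map_scalar
    (fun b => by
      obtain ⟨a, y, hy, hb⟩ := IsFractionRing.div_surjective (A := Y.presheaf.stalk P)
        (b : Y.functionField)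
      have hy0 : y ≠ 0 := nonZeroDivisors.ne_zero hy
      have hyK : algebraMap (Y.presheaf.stalk P) Y.functionField y ≠ 0 :=
        (map_ne_zero_iff _ (IsFractionRing.injective _ _)).2 hy0
      refine ⟨y, a, (map_ne_zero_iff _ hinj).2 hy0, Subtype.ext ?_⟩
      change algebraMap _ Y.functionField y * (b : Y.functionField) = algebraMap _ _ a
      rw [← hb, mul_div_cancel₀ _ hyK])
    ((map_ne_zero_iff _ hinj).2 hx0) (maximalIdeal_le_comap P hx)
  refine ⟨N, fun z hz => ?_⟩
  obtain ⟨c, hc⟩ := hN z hz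
  -- The partial sums are Cauchy because `x` lies in the maximal ideal; their limit in `Ô_P` has the
  -- same reductions as `z`.
  let y : AdicCompletion.AdicCauchySequence
      (IsLocalRing.maximalIdeal (Y.presheaf.stalk P)) (Y.presheaf.stalk P) :=
    .mk _ _ (fun n => ∑ l ∈ Finset.range n, x ^ l * c l) fun n => by
      rw [SModEq.sub_mem, Finset.sum_range_succ, sub_add_cancel_left, smul_eq_mul, Ideal.mul_top]
      exact neg_mem (Ideal.mul_mem_right _ _ (Ideal.pow_mem_pow hx n))
  refine ⟨AdicCompletion.mk _ _ y, sub_eq_zero.1 (φ.isCompletionSystem.eq_zero fun n => ?_)⟩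
  rw [map_sub, sub_eq_zero, hc n]
  exact φ.toQuotient_complMap n y

end Parametrization

end CompletedLocalRings

end CurveZeta

end

theorem corollary6 :
    ∃ univZeta : (d : ℕ) → AddSubmonoid (Fin d → ℕ) → MvPowerSeries (Fin d) ℤ[T;T⁻¹],
      ∀ (k : Type u) [Field k] (Y : Scheme.{u}) [IsIntegral Y]
        (f : Y ⟶ Spec (CommRingCat.of k)),
        CurveZeta.IsAlgebraicCurve f → CurveZeta.IsBigEnough f →
        ∀ P : Y, CurveZeta.IsSingular P →
        ∀ (d : ℕ) (φ : CurveZeta.Parametrization f P d),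
          CurveZeta.zeta φ.localRing =
            MvPowerSeries.map (CurveZeta.substLefschetz k)
              (univZeta d (CurveZeta.valueSemigroup φ.localRing)) :=
  ⟨CurveZeta.universalZeta, fun _ _ _ _ _ hf _ _ hP _ φ =>
    (φ.hasConductor hf hP).zeta_eq φ.hasEqualConst⟩
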